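/- Let $D$ be a closed disk and let $a\neq b$ be two interior points of $D$. Let $\sigma_0,\sigma_1$ be standard generators of $\pi_1(D\setminus\{a,b\},p)$, $p\in\partial D$: up to a homeomorphism of $D$, simple loops, each of which goes once around one of the points $a$, $b$ (respectively) and not around the other, and whose product is homotopic to $\partial D$. For an integer $m\ge 0$ let $L_{(m,2)}$ be the linear graph with vertices $v_0,\dots,v_m$ and edges $[v_i,v_{i+1}]$, $0\le i<m$, where $[v_i,v_{i+1}]$ has color $i \bmod 2$. Let $\tilde D$ be a closed disk and let $\phi:\tilde D\to D$ be a branched covering, branched at most over $a$ and $b$, that is represented by $L_{(m,2)}$: the $m+1$ points of $\phi^{-1}(p)$ can be labelled $v_0,\dots,v_m$ so that, for $c=0,1$, the monodromy along $\sigma_c$ is the product of the transpositions $(v_i\ v_{i+1})$ over all edges $[v_i,v_{i+1}]$ of color $c$. Let $\alpha$ be an arc in the interior of $D$ joining $a$ and $b$, and let $\tau_\alpha:D\to D$ be a half twist along $\alpha$: the homeomorphism that is the identity outside of a disk neighborhood of $\alpha$, is a half turn exchanging the ends of $\alpha$ on a smaller disk containing $\alpha$, and on the annulus in between rotates by an angle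 that goes linearly from $\pi$ to $0$. Then, for every integer $k$, there is a continuous map $T:\tilde D\to\tilde D$ that is the identity on $\partial\tilde D$ and satisfies $\tau_\alpha^k\circ\phi=\phi\circ T$ if and only if $k$ is a multiple of $m+1$. Moreover, the same equivalence holds if $T$ is required to be a homeomorphism. -/

import Mathlib

noncomputable section

/-! ### Edge-colored graphs and the permutations they define -/

/-- A graph on `V` whose edges carry colors in `Fin n`, two distinct edges with a common vertex
having different colors. Only the values of `color` on edges matter. -/
structure ColoredGraph (n : ℕ) (V : Type) where
  graph : SimpleGraph V
  color : Sym2 V → Fin n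
  proper : ∀ u v w, graph.Adj u v → graph.Adj u w → color s(u, v) = color s(u, w) → v = w

namespace ColoredGraph

variable {n : ℕ} {V : Type}

/-- `u` and `v` are joined by an edge of color `i`. -/
def AdjColor (G : ColoredGraph n V) (i : Fin n) (u v : V) : Prop :=
  G.graph.Adj u v ∧ G.color s(u, v) = i

theorem AdjColor.symm {G : ColoredGraph n V} {i : Fin n} {u v : V} (h : G.AdjColor i u v) :
    G.AdjColor i v u := ⟨h.1.symm, by rw [Sym2.eq_swap]; exact h.2⟩

theorem AdjColor.unique {G : ColoredGraph n V} {i : Fin n} {u v w : V}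
    (h : G.AdjColor i u v) (h' : G.AdjColor i u w) : v = w :=
  G.proper u v w h.1 h'.1 (h.2.trans h'.2.symm)

open Classical in
/-- The other end of the edge of color `i` at `u`, or `u` itself if there is no such edge. -/
def swapAlong (G : ColoredGraph n V) (i : Fin n) (u : V) : V :=
  if h : ∃ v, G.AdjColor i u v then h.choose else u

theorem swapAlong_of_adj {G : ColoredGraph n V} {i : Fin n} {u v : V} (h : G.AdjColor i u v) :
    G.swapAlong i u = v := by
  have hex : ∃ v, G.AdjColor i u v := ⟨v, h⟩
  rw [swapAlong, dif_pos hex]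
  exact hex.choose_spec.unique h

theorem swapAlong_of_not {G : ColoredGraph n V} {i : Fin n} {u : V}
    (h : ¬ ∃ v, G.AdjColor i u v) : G.swapAlong i u = u := by
  rw [swapAlong, dif_neg h]

theorem swapAlong_involutive (G : ColoredGraph n V) (i : Fin n) :
    Function.Involutive (G.swapAlong i) := by
  intro u
  by_cases h : ∃ v, G.AdjColor i u v
  · obtain ⟨v, hv⟩ := h
    rw [swapAlong_of_adj hv, swapAlong_of_adj hv.symm]
  · rw [swapAlong_of_not h, swapAlong_of_not h]

/-- The product of the (disjoint) transpositions `(u v)` over all edges `[u, v]` of color `i`. -/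
def perm (G : ColoredGraph n V) (i : Fin n) : Equiv.Perm V :=
  (G.swapAlong_involutive i).toPerm

end ColoredGraph

/-- The linear `2`-colored graph with vertices `v_0, …, v_m` and the `m` edges `[v_i, v_{i+1}]`,
the edge `[v_i, v_{i+1}]` having color `i` modulo `2`. -/
def linearGraph (m : ℕ) : ColoredGraph 2 (Fin (m + 1)) where
  graph := SimpleGraph.pathGraph (m + 1)
  color := Sym2.lift ⟨fun u v => Fin.ofNat 2 (min u.val v.val), fun u v => by
    simp only [min_comm]⟩
  proper := by
    intro u v w huv huw h
    rw [SimpleGraph.pathGraph_adj] at huv huw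
    simp only [Sym2.lift_mk, Fin.ext_iff, Fin.val_ofNat] at h
    ext
    omega

/-! ### The disk -/

/-- The closed unit disk of the complex plane. -/
abbrev Disk : Type := Metric.closedBall (0 : ℂ) 1

/-- The boundary circle of the disk. -/
def diskBoundary : Set Disk := {z | ‖(z : ℂ)‖ = 1}

/-- `α` is an arc in the interior of the disk with ends `a` and `b`. -/
def IsArc (α : Set Disk) (a b : Disk) : Prop :=
  ∃ γ : unitInterval → Disk, Continuous γ ∧ Function.Injective γ ∧ γ 0 = a ∧ γ 1 = b ∧
    Set.range γ = α ∧ Disjoint α diskBoundary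

/-! ### Half twists -/

/-- The angle of the model half twist, in units of `π`, at distance `r` from the origin: it is `1`
for `r ≤ 2 / 3`, decreases linearly to `0` on `[2 / 3, 5 / 6]`, and is `0` for `r ≥ 5 / 6`. -/
def twistAngle (r : ℝ) : ℝ := max 0 (min 1 (5 - 6 * r))

/-- Rotation of each circle `|z| = r` of the disk by the angle `c * π * twistAngle r`. -/
def diskTwist (c : ℝ) (z : Disk) : Disk :=
  ⟨z * Complex.exp ((c * Real.pi * twistAngle ‖(z : ℂ)‖ : ℝ) * Complex.I), by
    have hz := z.2
    rw [mem_closedBall_zero_iff] at hz ⊢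
    rw [norm_mul, Complex.norm_exp_ofReal_mul_I, mul_one]
    exact hz⟩

theorem continuous_diskTwist (c : ℝ) : Continuous (diskTwist c) := by
  unfold diskTwist twistAngle
  fun_prop

theorem diskTwist_neg_diskTwist (c : ℝ) (z : Disk) : diskTwist (-c) (diskTwist c z) = z := by
  apply Subtype.ext
  simp only [diskTwist, norm_mul, Complex.norm_exp_ofReal_mul_I, mul_one]
  rw [mul_assoc, ← Complex.exp_add, ← add_mul, ← Complex.ofReal_add]
  have h : c * Real.pi * twistAngle ‖(z : ℂ)‖ + -c * Real.pi * twistAngle ‖(z : ℂ)‖ = 0 := by ring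
  rw [h]
  simp

/-- The model half twist: a half turn of the disk `|z| ≤ 2 / 3` (which contains the segment from
`-1/2` to `1/2` in its interior), the identity on `|z| ≥ 5 / 6`, and on the annulus in between the
rotation angle goes linearly from `π` to `0`. -/
def modelHalfTwist : Disk ≃ₜ Disk where
  toFun := diskTwist 1
  invFun := diskTwist (-1)
  left_inv := diskTwist_neg_diskTwist 1
  right_inv z := by simpa using diskTwist_neg_diskTwist (-1) z
  continuous_toFun := continuous_diskTwist 1
  continuous_invFun := continuous_diskTwist (-1)

/-- The straight segment from `-1/2` to `1/2`. -/
def modelArc : Set Disk := {z | (z : ℂ).im = 0 ∧ |(z : ℂ).re| ≤ 1 / 2}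

/-- `τ` is a half twist of the disk around the arc `α`. In suitable coordinates `h` on the disk, in
which `α` becomes the standard segment, `τ` is the model half twist; so `τ` is the identity outside
of the disk neighborhood `h {|z| ≤ 5/6}` of `α`, rotates the smaller disk `h {|z| ≤ 2/3}` by a half
turn, and interpolates in the annulus between them. The coordinates may preserve or reverse the
orientation, so that half twists of both signs are included. -/
def IsHalfTwist (τ : Disk ≃ₜ Disk) (α : Set Disk) : Prop :=
  ∃ h : Disk ≃ₜ Disk, h '' modelArc = α ∧ ∀ z, τ (h z) = h (modelHalfTwist z)

/-! ### Standard generators of the fundamental group of the twice punctured disk -/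

/-- The point `-1/2`. -/
def leftPoint : Disk := ⟨-1 / 2, by rw [mem_closedBall_zero_iff]; norm_num⟩

/-- The point `1/2`. -/
def rightPoint : Disk := ⟨1 / 2, by rw [mem_closedBall_zero_iff]; norm_num⟩

/-- The point `-i`. -/
def bottomPoint : Disk := ⟨-Complex.I, by simp⟩

/-- The point `i`. -/
def topPoint : Disk := ⟨Complex.I, by simp⟩

/-- The diameter from `-i` to `i`, which passes between `-1/2` and `1/2`. -/
def diameter : Path bottomPoint topPoint where
  toFun t := ⟨((2 * (t : ℝ) - 1 : ℝ) : ℂ) * Complex.I, by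
    rw [mem_closedBall_zero_iff, norm_mul, Complex.norm_I, mul_one, Complex.norm_real,
      Real.norm_eq_abs, abs_le]
    constructor <;> linarith [t.2.1, t.2.2]⟩
  continuous_toFun := by fun_prop
  source' := by simp [bottomPoint]
  target' := by
    apply Subtype.ext
    simp only [topPoint, Set.Icc.coe_one]
    norm_num

/-- The point `exp (i θ)`. -/
def circlePoint (θ : ℝ) : Disk := ⟨Complex.exp (θ * Complex.I), by
  rw [mem_closedBall_zero_iff, Complex.norm_exp_ofReal_mul_I]⟩

theorem continuous_circlePoint : Continuous circlePoint := by
  unfold circlePoint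
  fun_prop

/-- The half of the boundary circle from `i` over `-1` to `-i`. -/
def leftSemicircle : Path topPoint bottomPoint where
  toFun t := circlePoint (Real.pi / 2 + Real.pi * t)
  continuous_toFun := continuous_circlePoint.comp (by fun_prop)
  source' := by
    apply Subtype.ext
    simp [circlePoint, topPoint, Complex.exp_pi_div_two_mul_I]
  target' := by
    apply Subtype.ext
    simp [circlePoint, bottomPoint, add_mul, Complex.exp_add, Complex.exp_pi_div_two_mul_I]

/-- The half of the boundary circle from `-i` over `1` to `i`. -/
def rightSemicircle : Path bottomPoint topPoint where
  toFun t := circlePoint (-(Real.pi / 2) + Real.pi * t)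
  continuous_toFun := continuous_circlePoint.comp (by fun_prop)
  source' := by
    apply Subtype.ext
    simp [circlePoint, bottomPoint, Complex.exp_neg, Complex.exp_pi_div_two_mul_I]
  target' := by
    apply Subtype.ext
    simp [circlePoint, topPoint, add_mul, Complex.exp_add, Complex.exp_neg,
      Complex.exp_pi_div_two_mul_I]

/-- The standard generators of the fundamental group of the disk without the points `-1/2` and
`1/2`, with base point `-i` on the boundary: simple loops, each going once counterclockwise around
one of the two points and not around the other. -/
def standardLoop (i : Fin 2) : Path bottomPoint bottomPoint :=
  ![diameter.trans leftSemicircle, rightSemicircle.trans diameter.symm] i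

/-- The loops `σ 0` and `σ 1` are standard generators of the fundamental group of the disk without
the points `a` and `b`, in the sense that some coordinates on the disk carry them to the model
picture. -/
def IsGeneratorPair {p : Disk} (σ : Fin 2 → Path p p) (a b : Disk) : Prop :=
  ∃ h : Disk ≃ₜ Disk, h leftPoint = a ∧ h rightPoint = b ∧
    ∀ i t, σ i t = h (standardLoop i t)

/-! ### Branched coverings of the disk by a disk -/

/-- `φ` is a branched covering of the disk by a disk, branched over (at most) the points of `P`:
it is a covering map away from `P`, the boundary is the preimage of the boundary, and near each
point of the preimage of `P` it has the form `z ↦ z ^ d` in suitable complex coordinates. -/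
structure IsBranchedCover (φ : Disk → Disk) (P : Set Disk) : Prop where
  continuous : Continuous φ
  covering : IsCoveringMapOn φ Pᶜ
  boundary : φ ⁻¹' diskBoundary = diskBoundary
  localForm : ∀ x, φ x ∈ P → ∃ d : ℕ, 1 ≤ d ∧ ∃ u w : ℂ → Disk,
    Topology.IsOpenEmbedding u ∧ Topology.IsOpenEmbedding w ∧ u 0 = x ∧ w 0 = φ x ∧
      ∀ z, φ (u z) = w (z ^ d)

/-- `φ` is represented by the colored graph `G` with respect to the loops `σ i`: after labelling
the points over the base point by the vertices of `G`, the monodromy along `σ i`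
is the product of the transpositions given by the edges of color `i`. -/
def IsRepresentedBy {n : ℕ} {V : Type} (φ : Disk → Disk) {p : Disk} (σ : Fin n → Path p p)
    (G : ColoredGraph n V) : Prop :=
  ∃ e : V ≃ φ ⁻¹' {p}, ∀ (i : Fin n) (v : V) (Γ : unitInterval → Disk), Continuous Γ →
    (∀ t, φ (Γ t) = σ i t) → Γ 0 = e v → Γ 1 = e (G.perm i v)

/-- `T` lifts `f` along `φ` and is the identity on the boundary. -/
def IsLift (φ f T : Disk → Disk) : Prop :=
  f ∘ φ = φ ∘ T ∧ ∀ z ∈ diskBoundary, T z = z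

end

open Topology Set

/-! ### Lifting maps and their uniqueness -/

/-! Choose coordinates on the disk in which `α` is the segment from −1/2 to 1/2 and the half twist
is the model one, and cut the disk along its real diameter. Away from the points over the branch
points, the covering disk is then assembled from lifts (`sheet`) of the closed upper and lower half
disks without ±1/2. There is one lift for each boundary point over ±i (`Pole`). Two permutations of
the poles record the gluing: `flip` crosses the middle segment of the diameter, and `rot` crosses
the outer end that comes next counterclockwise.

The boundary of the covering disk is a single circle, so `rot` is a single cycle
(`exists_rot_zpow_eq`), and there are 2(m+1) poles (`card_pole`). The monodromy around a branch
point is `turn = flip * rot`. The edges of one color give an involution, so `turn` squares to the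
identity; this is the dihedral relation flip rot flip = rot⁻¹. The generators `σ` come with
coordinates of their own, which need not be those of the twist. The relation is carried from one
system to the other by the condition `SquareLiftsClosed`, which mentions no coordinates.

A lift of the k-th power of the twist that fixes the boundary is forced on every half disk
(`twistedSheet`). Moving from the pole x towards the center, the image turns by kπ and arrives in
the half disk of rot^k x (`twistedSheet_zero`). The forced values on the sheets of x and flip x
agree along the middle segment iff rot^k (flip x) = flip (rot^k x). By the dihedral relation this
says rot^(2k) x = x, that is, 2(m+1) divides 2k (`twistedSheet_zero_flip_iff`). The outer ends
impose no condition, because they reach the boundary, where everything is fixed.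

If the condition holds, the pieces glue (`exists_continuousOn_twist`) and extend over the finitely
many points above the branch points (`exists_continuous_extension`). The lifts for k and −k are
inverse to each other (`lift_leftInverse`), so the lift is a homeomorphism. -/

theorem IsCoveringMapOn.exists_continuousOn_lift {E X V : Type*} [TopologicalSpace E]
    [TopologicalSpace X] [AddCommGroup V] [Module ℝ V] [TopologicalSpace V]
    [IsTopologicalAddGroup V] [ContinuousSMul ℝ V] {p : E → X} {s : Set X}
    (cov : IsCoveringMapOn p s) {K : Set V} {c : V} (hK : StarConvex ℝ c K) (hc : c ∈ K)
    {f : V → X} (hf : ContinuousOn f K) (hs : MapsTo f K s) {e : E} (he : p e = f c) :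
    ∃ F : V → E, ContinuousOn F K ∧ (∀ v ∈ K, p (F v) = f v) ∧ F c = e := by
  classical
  have hmem : ∀ (t : unitInterval) (v : K), (1 - (t : ℝ)) • c + (t : ℝ) • (v : V) ∈ K :=
    fun t v => hK v.2 (by linarith [t.2.2]) t.2.1 (by ring)
  have hcont : Continuous fun q : unitInterval × K =>
      (1 - (q.1 : ℝ)) • c + (q.1 : ℝ) • (q.2 : V) := by fun_prop
  -- `H` carries the contraction of `K` to `c` along segments. Its lift starting at the constant
  -- `e'`, taken at time 1, is the required lift of `f`.
  let H : C(unitInterval × K, s) :=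
    ⟨fun q => ⟨f ((1 - (q.1 : ℝ)) • c + (q.1 : ℝ) • (q.2 : V)), hs (hmem q.1 q.2)⟩, by
      refine Continuous.subtype_mk ?_ _
      exact hf.comp_continuous hcont fun q => hmem q.1 q.2⟩
  have hes : p e ∈ s := he ▸ hs hc
  let e' : p ⁻¹' s := ⟨e, hes⟩
  have cov' := cov.isCoveringMap_restrictPreimage
  have H0 : ∀ a : K, H (0, a) = s.restrictPreimage p (ContinuousMap.const K e' a) := by
    intro a
    apply Subtype.ext
    simp [H, e', he]
  let G := cov'.liftHomotopy H (ContinuousMap.const K e') H0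
  have hG : ∀ q, p (G q) = H q := fun q =>
    congrArg Subtype.val (congrFun (cov'.liftHomotopy_lifts H (ContinuousMap.const K e') H0) q)
  refine ⟨fun v => if hv : v ∈ K then (G (1, ⟨v, hv⟩) : E) else e, ?_, ?_, ?_⟩
  · rw [continuousOn_iff_continuous_domRestrict]
    have : K.domRestrict (fun v => if hv : v ∈ K then (G (1, ⟨v, hv⟩) : E) else e) =
        fun v : K => (G (1, v) : E) := by
      ext v
      simp [v.2]
    rw [this]
    fun_prop
  · intro v hv
    simp only [hv, dite_true, hG]
    simp [H]
  · simp only [hc, dite_true]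
    -- The segment from `c` to `c` is constant, so its lift never leaves `e'`.
    have hconst : ∀ t : unitInterval, G (t, ⟨c, hc⟩) = e' := by
      have key := cov'.const_of_comp (A := unitInterval)
        (g := fun t => G (t, ⟨c, hc⟩)) (by fun_prop) ?_
      · intro t
        rw [key t 0]
        exact cov'.liftHomotopy_zero H (ContinuousMap.const K e') H0 _
      · intro t t'
        apply Subtype.ext
        change p (G _) = p (G _)
        rw [hG, hG]
        simp only [H, ContinuousMap.coe_mk]
        congr 1
        rw [← add_smul, ← add_smul]
        simp
    rw [hconst 1]

theorem IsCoveringMapOn.eqOn_of_lifts {E X Y : Type*} [TopologicalSpace E] [T2Space E]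
    [TopologicalSpace X] [TopologicalSpace Y] {p : E → X} {s : Set X}
    (cov : IsCoveringMapOn p s) {K : Set Y} (hK : IsPreconnected K) {F G : Y → E}
    (hF : ContinuousOn F K) (hG : ContinuousOn G K) (h : ∀ y ∈ K, p (F y) = p (G y))
    (hs : ∀ y ∈ K, p (F y) ∈ s) {y₀ : Y} (hy : y₀ ∈ K) (h₀ : F y₀ = G y₀) : EqOn F G K := by
  have cov' := cov.isCoveringMap_restrictPreimage
  have : PreconnectedSpace K := isPreconnected_iff_preconnectedSpace.mp hK
  have key := cov'.eq_of_comp_eq (A := K)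
    (g₁ := fun y => ⟨F y, hs y y.2⟩) (g₂ := fun y => ⟨G y, by
      have := hs y y.2; rw [h y y.2] at this; exact this⟩)
    (by
      refine Continuous.subtype_mk ?_ _
      exact continuousOn_iff_continuous_domRestrict.mp hF)
    (by
      refine Continuous.subtype_mk ?_ _
      exact continuousOn_iff_continuous_domRestrict.mp hG)
    (by
      ext y
      simpa using h y y.2) ⟨y₀, hy⟩ (Subtype.ext h₀)
  intro y hy'
  exact congrArg Subtype.val (congrFun key ⟨y, hy'⟩)

theorem Complex.exists_continuousOn_log {V : Type*} [AddCommGroup V] [Module ℝ V]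
    [TopologicalSpace V] [IsTopologicalAddGroup V] [ContinuousSMul ℝ V] {K : Set V} {c : V}
    (hK : StarConvex ℝ c K) (hc : c ∈ K) {f : V → ℂ} (hf : ContinuousOn f K)
    (h0 : ∀ v ∈ K, f v ≠ 0) {l : ℂ} (hl : Complex.exp l = f c) :
    ∃ F : V → ℂ, ContinuousOn F K ∧ (∀ v ∈ K, Complex.exp (F v) = f v) ∧ F c = l :=
  Complex.isCoveringMapOn_exp.exists_continuousOn_lift hK hc hf (fun v hv => h0 v hv) hl

/-- If two continuous functions on a preconnected set have the same exponential and differ by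
`d` at one point, then they differ by `d` everywhere. -/
theorem Complex.eqOn_add_of_exp_eq {Y : Type*} [TopologicalSpace Y] {K : Set Y}
    (hK : IsPreconnected K) {F G : Y → ℂ} (hF : ContinuousOn F K) (hG : ContinuousOn G K)
    (h : ∀ y ∈ K, Complex.exp (F y) = Complex.exp (G y)) {d : ℂ} {y₀ : Y} (hy : y₀ ∈ K)
    (h₀ : F y₀ = G y₀ + d) : ∀ y ∈ K, F y = G y + d := by
  have hd : Complex.exp d = 1 := by
    have := h y₀ hy
    rw [h₀, Complex.exp_add] at this
    exact mul_left_cancel₀ (Complex.exp_ne_zero _) (by rw [this, mul_one])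
  exact Complex.isCoveringMapOn_exp.eqOn_of_lifts hK hF (hG.add continuousOn_const)
    (fun y hy => by rw [h y hy, Complex.exp_add, hd, mul_one])
    (fun y _ => Complex.exp_ne_zero _) hy h₀

/-! ### The disk -/

/-- The radial retraction of the plane onto the closed unit disk. -/
noncomputable def toDisk (z : ℂ) : Disk := ⟨z / (max 1 ‖z‖ : ℝ), by
  rw [mem_closedBall_zero_iff, norm_div, Complex.norm_real, Real.norm_eq_abs,
    abs_of_pos (lt_max_of_lt_left one_pos)]
  exact div_le_one_of_le₀ (le_max_right _ _) (le_max_of_le_left zero_le_one)⟩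

theorem continuous_toDisk : Continuous toDisk := by
  refine Continuous.subtype_mk ?_ _
  refine continuous_id.div (by fun_prop) fun z => ?_
  exact_mod_cast (lt_max_of_lt_left one_pos).ne'

theorem coe_toDisk {z : ℂ} (hz : ‖z‖ ≤ 1) : (toDisk z : ℂ) = z := by
  simp [toDisk, max_eq_left hz]

theorem toDisk_coe (z : Disk) : toDisk z = z :=
  Subtype.ext (coe_toDisk (mem_closedBall_zero_iff.mp z.2))

theorem Disk.norm_le (z : Disk) : ‖(z : ℂ)‖ ≤ 1 := mem_closedBall_zero_iff.mp z.2

/-- There is no continuous logarithm of `z - x` on a circle around `x`. -/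
theorem not_continuous_log_circle (x : ℂ) {r : ℝ} (hr : 0 < r) (L : ℝ → ℂ) (hL : Continuous L)
    (h2 : L (2 * Real.pi) = L 0)
    (h : ∀ t : ℝ, Complex.exp (L t) = (x + r * Complex.exp (t * Complex.I)) - x) : False := by
  have key := Complex.eqOn_add_of_exp_eq (K := (univ : Set ℝ)) isPreconnected_univ
    (F := L) (G := fun t => Real.log r + t * Complex.I) (d := L 0 - Real.log r) (y₀ := 0)
    hL.continuousOn (by fun_prop) (fun t _ => by
      rw [h, Complex.exp_add, ← Complex.ofReal_exp, Real.exp_log hr]; ring) (mem_univ _) (by simp)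
  have h1 := key (2 * Real.pi) (mem_univ _)
  rw [h2] at h1
  have h3 : (2 * Real.pi : ℂ) * Complex.I = 0 := by
    push_cast at h1
    linear_combination -h1
  simp [Real.pi_ne_zero, Complex.I_ne_zero] at h3

/-- Removing a boundary point leaves the disk star-shaped around 0. If `h` took an interior point
`x` to the boundary, `h.symm z - x` would have a logarithm on that star-shaped set. Pulled back by
`h`, it would be a logarithm of `z - x` on a circle around `x`. -/
theorem Homeomorph.mem_diskBoundary_of_apply_mem (h : Disk ≃ₜ Disk) {x : Disk}
    (hx : h x ∈ diskBoundary) : x ∈ diskBoundary := by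
  by_contra hxb
  have hlt : ‖(x : ℂ)‖ < 1 := lt_of_le_of_ne x.norm_le hxb
  have hx1 : ‖(h x : ℂ)‖ = 1 := hx
  let K : Set ℂ := {z | ‖z‖ ≤ 1 ∧ z ≠ h x}
  have hK : StarConvex ℝ 0 K := by
    rw [starConvex_zero_iff]
    rintro z ⟨hz, hne⟩ a ha0 ha1
    have hle : ‖a • z‖ ≤ a := by
      rw [norm_smul, Real.norm_eq_abs, abs_of_nonneg ha0]
      exact mul_le_of_le_one_right ha0 hz
    refine ⟨hle.trans ha1, fun he => ?_⟩
    have ha : a = 1 := le_antisymm ha1 (by rw [← hx1, ← he]; exact hle)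
    rw [ha, one_smul] at he
    exact hne he
  have h0K : (0 : ℂ) ∈ K := ⟨by simp, fun he => by rw [← he] at hx1; simp at hx1⟩
  let f : ℂ → ℂ := fun z => (h.symm (toDisk z) : ℂ) - x
  have hf : Continuous f :=
    (continuous_subtype_val.comp (h.symm.continuous.comp continuous_toDisk)).sub continuous_const
  have hf0 : ∀ z ∈ K, f z ≠ 0 := by
    rintro z ⟨hz, hne⟩ he
    have h1 : h.symm (toDisk z) = x := Subtype.ext (sub_eq_zero.mp he)
    have h2 : toDisk z = h x := by rw [← h1, h.apply_symm_apply]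
    exact hne (by rw [← h2, coe_toDisk hz])
  obtain ⟨F, hFc, hF, -⟩ := Complex.exists_continuousOn_log hK h0K hf.continuousOn hf0
    (Complex.exp_log (hf0 0 h0K))
  -- With this radius the circle around `x` stays inside the closed disk.
  set r : ℝ := 1 - ‖(x : ℂ)‖ with hr
  have hr0 : 0 < r := by linarith
  have hin : ∀ t : ℝ, ‖(x : ℂ) + r * Complex.exp (t * Complex.I)‖ ≤ 1 := by
    intro t
    refine (norm_add_le _ _).trans ?_
    rw [norm_mul, Complex.norm_exp_ofReal_mul_I, Complex.norm_real, Real.norm_eq_abs,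
      abs_of_pos hr0]
    linarith
  let c : ℝ → Disk := fun t => toDisk (x + r * Complex.exp (t * Complex.I))
  have hc : Continuous c := continuous_toDisk.comp (by fun_prop)
  have hcv : ∀ t, (c t : ℂ) = x + r * Complex.exp (t * Complex.I) := fun t => coe_toDisk (hin t)
  have hcK : ∀ t, (h (c t) : ℂ) ∈ K := by
    refine fun t => ⟨(h (c t)).norm_le, fun he => ?_⟩
    have h1 : (c t : ℂ) = x := congrArg Subtype.val (h.injective (Subtype.ext he))
    rw [hcv] at h1
    have h2 : (r : ℂ) * Complex.exp (t * Complex.I) = 0 := by linear_combination h1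
    simp [Complex.exp_ne_zero] at h2
    linarith
  refine not_continuous_log_circle x hr0 (fun t => F (h (c t)))
    (hFc.comp_continuous (continuous_subtype_val.comp (h.continuous.comp hc)) hcK) ?_ ?_
  · have : c (2 * Real.pi) = c 0 := by
      apply Subtype.ext
      rw [hcv, hcv]
      simp
    simp only [this]
  · intro t
    rw [hF _ (hcK t), ← hcv]
    simp [f, toDisk_coe]

theorem Homeomorph.apply_mem_diskBoundary_iff (h : Disk ≃ₜ Disk) {x : Disk} :
    h x ∈ diskBoundary ↔ x ∈ diskBoundary :=
  ⟨h.mem_diskBoundary_of_apply_mem, fun hx =>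
    h.symm.mem_diskBoundary_of_apply_mem (by simpa using hx)⟩

/-! ### Ends of arcs -/

theorem unitInterval_endpoints_of_bijective {e : unitInterval → unitInterval} (he : Continuous e)
    (hb : Function.Bijective e) : (e 0 = 0 ∧ e 1 = 1) ∨ (e 0 = 1 ∧ e 1 = 0) := by
  obtain ⟨x, hx⟩ := hb.2 0
  obtain ⟨y, hy⟩ := hb.2 1
  rcases he.strictMono_of_inj_boundedOrder' hb.1 with hm | hm
  · left
    constructor
    · exact le_antisymm ((hm.monotone unitInterval.nonneg').trans_eq hx) unitInterval.nonneg'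
    · exact le_antisymm unitInterval.le_one' (hy.ge.trans (hm.monotone unitInterval.le_one'))
  · right
    constructor
    · exact le_antisymm unitInterval.le_one' (hy ▸ hm.antitone unitInterval.nonneg')
    · exact le_antisymm (hx ▸ hm.antitone unitInterval.le_one') unitInterval.nonneg'

/-- Both parametrizations are embeddings, so they differ by a continuous bijection of the interval.
Such a bijection is strictly monotone and preserves or exchanges the ends. -/
theorem arc_ends_unique {X : Type*} [TopologicalSpace X] [T2Space X] {γ δ : unitInterval → X}
    (hγ : Continuous γ) (hγi : Function.Injective γ) (hδ : Continuous δ)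
    (hδi : Function.Injective δ) (h : range δ = range γ) :
    ({δ 0, δ 1} : Set X) = {γ 0, γ 1} := by
  have emb : IsEmbedding γ := (hγ.isClosedEmbedding hγi).isEmbedding
  have hex : ∀ t, ∃ u, γ u = δ t := fun t => by
    have : δ t ∈ range γ := h ▸ mem_range_self t
    exact this
  choose e he using hex
  have hec : Continuous e := emb.continuous_iff.mpr (by
    have : γ ∘ e = δ := funext he
    rw [this]; exact hδ)
  have heb : Function.Bijective e := by
    refine ⟨fun s t hst => hδi (by rw [← he, ← he, hst]), fun u => ?_⟩
    have : γ u ∈ range δ := h ▸ mem_range_self u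
    obtain ⟨t, ht⟩ := this
    exact ⟨t, hγi (by rw [he, ht])⟩
  rcases unitInterval_endpoints_of_bijective hec heb with ⟨h0, h1⟩ | ⟨h0, h1⟩
  · rw [← he 0, ← he 1, h0, h1]
  · rw [← he 0, ← he 1, h0, h1, pair_comm]

/-- The coordinates of the half twist match ±1/2 with the branch points only up to order, hence an
equality of sets. -/
theorem IsArc.ends_eq {α : Set Disk} {a b : Disk} (hα : IsArc α a b) {h : Disk ≃ₜ Disk}
    (hh : h '' modelArc = α) : ({h leftPoint, h rightPoint} : Set Disk) = {a, b} := by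
  obtain ⟨γ, hγ, hγi, h0, h1, hr, -⟩ := hα
  let s : unitInterval → ℂ := fun t => (((t : ℝ) - 1 / 2 : ℝ) : ℂ)
  have hs : ∀ t, ‖s t‖ ≤ 1 := fun t => by
    simp only [s]
    rw [Complex.norm_real, Real.norm_eq_abs, abs_le]
    constructor <;> linarith [t.2.1, t.2.2]
  let δ : unitInterval → Disk := fun t => h (toDisk (s t))
  have hδ : Continuous δ := h.continuous.comp (continuous_toDisk.comp (by fun_prop))
  have hδi : Function.Injective δ := by
    intro t u htu
    have h2 := congrArg Subtype.val (h.injective htu)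
    rw [coe_toDisk (hs t), coe_toDisk (hs u)] at h2
    simp only [s] at h2
    have h3 := Complex.ofReal_injective h2
    exact Subtype.ext (by linarith)
  have hrange : range δ = range γ := by
    rw [hr, ← hh]
    ext z
    constructor
    · rintro ⟨t, rfl⟩
      refine ⟨_, ⟨?_, ?_⟩, rfl⟩
      · rw [coe_toDisk (hs t)]
        simp only [s, Complex.ofReal_im]
      · rw [coe_toDisk (hs t)]
        simp only [s, Complex.ofReal_re]
        rw [abs_le]
        constructor <;> linarith [t.2.1, t.2.2]
    · rintro ⟨w, ⟨hw1, hw2⟩, rfl⟩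
      rw [abs_le] at hw2
      refine ⟨⟨(w : ℂ).re + 1 / 2, by constructor <;> linarith⟩, ?_⟩
      simp only [δ]
      congr 1
      apply Subtype.ext
      rw [coe_toDisk (hs _)]
      apply Complex.ext <;> simp [s, hw1]
  have key := arc_ends_unique hγ hγi hδ hδi hrange
  have e0 : δ 0 = h leftPoint := by
    simp only [δ]
    congr 1
    apply Subtype.ext
    rw [coe_toDisk (hs _)]
    simp [s, leftPoint]
    norm_num
  have e1 : δ 1 = h rightPoint := by
    simp only [δ]
    congr 1
    apply Subtype.ext
    rw [coe_toDisk (hs _)]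
    simp [s, rightPoint]
    norm_num
  rw [← h0, ← h1, ← e0, ← e1, key]

/-! ### Coverings of the disk branched over two points, in coordinates -/

/-- The closed unit disk without the two points `±1/2`. -/
def unbranchedDisk : Set ℂ := {z | ‖z‖ ≤ 1 ∧ z ≠ 1 / 2 ∧ z ≠ -1 / 2}

/-- The properties of a covering of the unit disk by a disk, branched over `±1/2`, that concern
its restriction to the complement of the branch points. -/
structure DiskCover (ψ : Disk → ℂ) : Prop where
  continuous : Continuous ψ
  norm_le : ∀ x, ‖ψ x‖ ≤ 1
  norm_eq_one_iff : ∀ x, ‖ψ x‖ = 1 ↔ ‖(x : ℂ)‖ = 1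
  exists_lift : ∀ {V : Type} [NormedAddCommGroup V] [NormedSpace ℝ V] {K : Set V} {c : V}
    {f : V → ℂ} {x : Disk}, StarConvex ℝ c K → c ∈ K → ContinuousOn f K →
    MapsTo f K unbranchedDisk → ψ x = f c →
    ∃ F : V → Disk, ContinuousOn F K ∧ (∀ v ∈ K, ψ (F v) = f v) ∧ F c = x
  eqOn_of_lifts : ∀ {Y : Type} [TopologicalSpace Y] {K : Set Y} {F G : Y → Disk},
    IsPreconnected K → ContinuousOn F K → ContinuousOn G K → (∀ y ∈ K, ψ (F y) = ψ (G y)) →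
    (∀ y ∈ K, ψ (F y) ∈ unbranchedDisk) → ∀ {y₀}, y₀ ∈ K → F y₀ = G y₀ → EqOn F G K
  injOn_nhds : ∀ x, ψ x ∈ unbranchedDisk → ∃ O ∈ 𝓝 x, InjOn ψ O

theorem coe_leftPoint : (leftPoint : ℂ) = -1 / 2 := rfl

theorem coe_rightPoint : (rightPoint : ℂ) = 1 / 2 := rfl

theorem coe_mem_unbranchedDisk_iff {z : Disk} :
    (z : ℂ) ∈ unbranchedDisk ↔ z ∉ ({leftPoint, rightPoint} : Set Disk) := by
  simp only [unbranchedDisk, mem_ofPred_eq, z.norm_le, true_and, mem_insert_iff,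
    mem_singleton_iff, not_or, Subtype.ext_iff, coe_leftPoint, coe_rightPoint]
  tauto

/-- The coordinates `h` are left free because two systems are needed: those of the generators and
those of the twist. -/
theorem IsBranchedCover.diskCover {φ : Disk → Disk} {P : Set Disk} (hφ : IsBranchedCover φ P)
    {h : Disk ≃ₜ Disk} (hP : ({h leftPoint, h rightPoint} : Set Disk) = P) :
    DiskCover (fun x => (h.symm (φ x) : ℂ)) := by
  have hmem : ∀ z : Disk, (h.symm z : ℂ) ∈ unbranchedDisk ↔ z ∈ Pᶜ := by
    intro z
    rw [coe_mem_unbranchedDisk_iff, ← hP, mem_compl_iff]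
    simp only [mem_insert_iff, mem_singleton_iff, h.symm_apply_eq]
  have hcoe : ∀ z w : Disk, (h.symm z : ℂ) = (h.symm w : ℂ) ↔ z = w := fun z w =>
    ⟨fun e => h.symm.injective (Subtype.ext e), fun e => by rw [e]⟩
  refine ⟨?_, fun x => Disk.norm_le _, ?_, ?_, ?_, ?_⟩
  · exact continuous_subtype_val.comp (h.symm.continuous.comp hφ.continuous)
  · intro x
    have h1 := h.symm.apply_mem_diskBoundary_iff (x := φ x)
    have h2 : φ x ∈ diskBoundary ↔ x ∈ diskBoundary := by
      rw [← mem_preimage, hφ.boundary]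
    exact h1.trans h2
  · intro V _ _ K c f x hK hc hf hs hx
    have hfK : ∀ v ∈ K, (toDisk (f v) : ℂ) = f v := fun v hv => coe_toDisk (hs hv).1
    obtain ⟨F, hF, hFv, hFc⟩ := hφ.covering.exists_continuousOn_lift hK hc
      (f := fun v => h (toDisk (f v)))
      ((h.continuous.comp continuous_toDisk).comp_continuousOn hf)
      (fun v hv => by
        rw [← hmem, h.symm_apply_apply, hfK v hv]
        exact hs hv) (e := x) (by
        rw [← hcoe, h.symm_apply_apply, hfK c hc]
        exact hx)
    refine ⟨F, hF, fun v hv => ?_, hFc⟩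
    rw [hFv v hv, h.symm_apply_apply, hfK v hv]
  · intro Y _ K F G hK hF hG hFG hs y₀ hy h₀
    exact hφ.covering.eqOn_of_lifts hK hF hG (fun y hy => (hcoe _ _).mp (hFG y hy))
      (fun y hy => (hmem _).mp (hs y hy)) hy h₀
  · intro x hx
    obtain ⟨e, hxe, he⟩ := hφ.covering.isLocalHomeomorphOn x ((hmem _).mp hx)
    refine ⟨e.source, e.open_source.mem_nhds hxe, fun y hy z hz hyz => ?_⟩
    have := (hcoe _ _).mp hyz
    rw [he] at this
    exact e.injOn hy hz this

/-- The right half of the closed unit disk without the points `±i/2`. -/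
def halfDisk : Set ℂ := {z | ‖z‖ ≤ 1 ∧ 0 ≤ z.re ∧ z ≠ Complex.I / 2 ∧ z ≠ -(Complex.I / 2)}

theorem one_mem_halfDisk : (1 : ℂ) ∈ halfDisk := by
  refine ⟨by simp, by simp, fun h => ?_, fun h => ?_⟩ <;>
  · have := congrArg Complex.re h
    simp at this

theorem mem_halfDisk_of_re_pos {z : ℂ} (h1 : ‖z‖ ≤ 1) (h : 0 < z.re) : z ∈ halfDisk := by
  refine ⟨h1, h.le, fun e => ?_, fun e => ?_⟩ <;>
  · rw [e] at h
    simp at h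

theorem mem_halfDisk_of_norm_ne {z : ℂ} (h1 : ‖z‖ ≤ 1) (h : 0 ≤ z.re) (h2 : ‖z‖ ≠ 1 / 2) :
    z ∈ halfDisk := by
  refine ⟨h1, h, fun e => ?_, fun e => ?_⟩ <;>
  · rw [e] at h2
    simp at h2

theorem ofReal_mul_I_mem_halfDisk {t : ℝ} (h1 : |t| ≤ 1) (h2 : |t| ≠ 1 / 2) :
    (t * Complex.I : ℂ) ∈ halfDisk :=
  mem_halfDisk_of_norm_ne (by simpa using h1) (by simp) (by simpa using h2)

/-- A segment from 1 has positive real part except possibly at its far end, so it avoids ±i/2. The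
center 0 would not do, since the radii to ±i pass through the removed points. -/
theorem starConvex_halfDisk : StarConvex ℝ 1 halfDisk := by
  intro z hz a b ha hb hab
  have hn : ‖a • (1 : ℂ) + b • z‖ ≤ 1 := by
    refine (norm_add_le _ _).trans ?_
    rw [norm_smul, norm_smul, Real.norm_eq_abs, Real.norm_eq_abs, abs_of_nonneg ha,
      abs_of_nonneg hb, norm_one, mul_one]
    nlinarith [hz.1]
  rcases ha.eq_or_lt with rfl | ha
  · rw [zero_add] at hab
    simpa [hab] using hz
  · refine mem_halfDisk_of_re_pos hn ?_
    simp only [Complex.add_re, Complex.real_smul, Complex.re_ofReal_mul, Complex.one_re]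
    have := hz.2.1
    positivity

theorem isPreconnected_halfDisk : IsPreconnected halfDisk :=
  (starConvex_halfDisk.isPathConnected one_mem_halfDisk).isConnected.isPreconnected

/-- Multiplication by i or −i turns the right half disk into the upper or lower one and takes the
points ±i/2 to the branch points ±1/2. -/
theorem mul_mem_unbranchedDisk {s z : ℂ} (hs : s = Complex.I ∨ s = -Complex.I)
    (hz : z ∈ halfDisk) : s * z ∈ unbranchedDisk := by
  obtain ⟨h1, -, h2, h3⟩ := hz
  have hI := Complex.I_mul_I
  rcases hs with rfl | rfl
  · refine ⟨by simpa using h1, fun e => h3 ?_, fun e => h2 ?_⟩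
    · linear_combination (-Complex.I) * e + z * hI
    · linear_combination (-Complex.I) * e + z * hI
  · refine ⟨by simpa using h1, fun e => h2 ?_, fun e => h3 ?_⟩
    · linear_combination (Complex.I) * e + z * hI
    · linear_combination (Complex.I) * e + z * hI

/-- The points over `±i`. -/
def Pole (ψ : Disk → ℂ) : Type := {x : Disk // ψ x = Complex.I ∨ ψ x = -Complex.I}

namespace Pole

variable {ψ : Disk → ℂ}

/-- The image of a point over `±i`. -/
def base (x : Pole ψ) : ℂ := ψ x.1

theorem base_eq (x : Pole ψ) : x.base = Complex.I ∨ x.base = -Complex.I := x.2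

theorem base_ne_zero (x : Pole ψ) : x.base ≠ 0 := by
  rcases x.base_eq with h | h <;> simp [h, Complex.I_ne_zero]

theorem norm_base (x : Pole ψ) : ‖x.base‖ = 1 := by
  rcases x.base_eq with h | h <;> simp [h]

theorem base_eq_or (x y : Pole ψ) : y.base = x.base ∨ y.base = -x.base := by
  rcases x.base_eq with h | h <;> rcases y.base_eq with h' | h' <;> simp [h, h']

end Pole

/-! ### Sheets over the half disks and their adjacency -/

namespace DiskCover

variable {ψ : Disk → ℂ} (hψ : DiskCover ψ)
include hψ

theorem exists_sheet (x : Pole ψ) : ∃ F : ℂ → Disk, ContinuousOn F halfDisk ∧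
    (∀ z ∈ halfDisk, ψ (F z) = x.base * z) ∧ F 1 = x.1 :=
  hψ.exists_lift starConvex_halfDisk one_mem_halfDisk (by fun_prop)
    (fun _ hz => mul_mem_unbranchedDisk x.base_eq hz) (by simp [Pole.base])

/-- The lift of the half disk around the point `x` over `±i`, rotated to be the right half. -/
noncomputable def sheet (x : Pole ψ) : ℂ → Disk := (hψ.exists_sheet x).choose

theorem continuousOn_sheet (x : Pole ψ) : ContinuousOn (hψ.sheet x) halfDisk :=
  (hψ.exists_sheet x).choose_spec.1

theorem apply_sheet (x : Pole ψ) {z : ℂ} (hz : z ∈ halfDisk) :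
    ψ (hψ.sheet x z) = x.base * z :=
  (hψ.exists_sheet x).choose_spec.2.1 z hz

theorem sheet_one (x : Pole ψ) : hψ.sheet x 1 = x.1 := (hψ.exists_sheet x).choose_spec.2.2

theorem eq_sheet (x : Pole ψ) {Y : Type} [TopologicalSpace Y] {K : Set Y} (hK : IsPreconnected K)
    {F : Y → Disk} {g : Y → ℂ} (hF : ContinuousOn F K) (hg : ContinuousOn g K)
    (hgK : ∀ y ∈ K, g y ∈ halfDisk) (h : ∀ y ∈ K, ψ (F y) = x.base * g y) {y₀ : Y} (hy₀ : y₀ ∈ K)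
    (h₀ : F y₀ = hψ.sheet x (g y₀)) {y : Y} (hy : y ∈ K) : F y = hψ.sheet x (g y) :=
  hψ.eqOn_of_lifts hK hF ((hψ.continuousOn_sheet x).comp hg hgK)
    (fun y hy => by rw [h y hy, Function.comp_apply, hψ.apply_sheet x (hgK y hy)])
    (fun y hy => by rw [h y hy]; exact mul_mem_unbranchedDisk x.base_eq (hgK y hy)) hy₀ h₀ hy

/-- Lifts of the same half disk that meet in one point coincide, in particular at 1. Equalities
between poles are proved this way. -/
theorem sheet_injective {x y : Pole ψ} {z : ℂ} (hz : z ∈ halfDisk) (hb : x.base = y.base)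
    (h : hψ.sheet x z = hψ.sheet y z) : x = y := by
  have := hψ.eq_sheet y isPreconnected_halfDisk (hψ.continuousOn_sheet x) continuousOn_id
    (fun _ h => h) (fun w hw => by rw [hψ.apply_sheet x hw, hb]; rfl) hz h one_mem_halfDisk
  simp only [id, hψ.sheet_one] at this
  exact Subtype.ext this

/-- Lifting the segment from `z` back to 1, starting at `y`, ends at the pole whose sheet contains
`y`. -/
theorem exists_sheet_eq {y : Disk} {s z : ℂ} (hs : s = Complex.I ∨ s = -Complex.I)
    (hz : z ∈ halfDisk) (h : ψ y = s * z) :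
    ∃ x : Pole ψ, x.base = s ∧ hψ.sheet x z = y := by
  let g : ℝ → ℂ := fun t => (1 - t) • (1 : ℂ) + t • z
  have hg : Continuous g := by fun_prop
  have hgK : ∀ t ∈ Icc (0 : ℝ) 1, g t ∈ halfDisk := fun t ht =>
    starConvex_halfDisk hz (by linarith [ht.2]) ht.1 (by ring)
  obtain ⟨F, hF, hFt, hF1⟩ := hψ.exists_lift (K := Icc (0 : ℝ) 1) (c := 1)
    (f := fun t => s * g t) (x := y) ((convex_Icc (0 : ℝ) 1).starConvex (by simp)) (by simp)
    (by fun_prop) (fun t ht => mul_mem_unbranchedDisk hs (hgK t ht)) (by simp [g, h])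
  have h0 : ψ (F 0) = s := by rw [hFt 0 (by simp)]; simp [g]
  refine ⟨⟨F 0, by rwa [h0]⟩, h0, ?_⟩
  have hs1 : hψ.sheet ⟨F 0, by rwa [h0]⟩ 1 = F 0 := hψ.sheet_one _
  have key := hψ.eq_sheet ⟨F 0, by rwa [h0]⟩ (isPreconnected_Icc (a := (0 : ℝ)) (b := 1)) hF
    hg.continuousOn hgK (fun t ht => by rw [hFt t ht]; exact congrArg (· * g t) h0.symm)
    (y₀ := 0) (by simp) (by simp [g, hs1]) (y := 1) (by simp)
  rw [← hF1, key]
  simp [g]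

/-- If `z` and `-z` both lie in the half disk, then `z` is imaginary and its image lies on the
diameter. The same image is `-x.base * -z`, so the point also belongs to a sheet on the other side.
-/
theorem exists_neg_sheet (x : Pole ψ) {z : ℂ} (hz : z ∈ halfDisk) (hz' : -z ∈ halfDisk) :
    ∃ y : Pole ψ, y.base = -x.base ∧ hψ.sheet y (-z) = hψ.sheet x z := by
  refine hψ.exists_sheet_eq ?_ hz' ?_
  · rcases x.base_eq with h | h <;> simp [h]
  · rw [hψ.apply_sheet x hz]
    ring

omit hψ in
theorem zero_mem_halfDisk : (0 : ℂ) ∈ halfDisk :=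
  mem_halfDisk_of_norm_ne (by simp) (by simp) (by simp)

omit hψ in
theorem I_mem_halfDisk : Complex.I ∈ halfDisk :=
  mem_halfDisk_of_norm_ne (by simp) (by simp) (by simp)

omit hψ in
theorem neg_I_mem_halfDisk : -Complex.I ∈ halfDisk :=
  mem_halfDisk_of_norm_ne (by simp) (by simp) (by simp)

/-- The half disk that meets the sheet of `x` along the middle part of the diameter. -/
noncomputable def flipFun (x : Pole ψ) : Pole ψ :=
  (hψ.exists_neg_sheet x zero_mem_halfDisk (by simpa using zero_mem_halfDisk)).choose

theorem flipFun_spec (x : Pole ψ) : (hψ.flipFun x).base = -x.base ∧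
    hψ.sheet (hψ.flipFun x) (-0) = hψ.sheet x 0 :=
  (hψ.exists_neg_sheet x zero_mem_halfDisk (by simpa using zero_mem_halfDisk)).choose_spec

theorem flipFun_involutive : Function.Involutive hψ.flipFun := fun x => by
  obtain ⟨h1, h2⟩ := hψ.flipFun_spec x
  obtain ⟨h3, h4⟩ := hψ.flipFun_spec (hψ.flipFun x)
  rw [neg_zero] at h2 h4
  exact hψ.sheet_injective zero_mem_halfDisk (by rw [h3, h1, neg_neg]) (h4.trans h2)

/-- Passing to the half disk on the other side of the middle part of the diameter. -/
noncomputable def flip : Equiv.Perm (Pole ψ) := hψ.flipFun_involutive.toPerm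

theorem base_flip (x : Pole ψ) : (hψ.flip x).base = -x.base := (hψ.flipFun_spec x).1

theorem sheet_flip_zero (x : Pole ψ) : hψ.sheet (hψ.flip x) 0 = hψ.sheet x 0 := by
  have := (hψ.flipFun_spec x).2
  rwa [neg_zero] at this

theorem flip_flip (x : Pole ψ) : hψ.flip (hψ.flip x) = x := hψ.flipFun_involutive x

/-- The half disk that meets the sheet of `x` along the end of the diameter reached by a
counterclockwise rotation. -/
noncomputable def rotFun (x : Pole ψ) : Pole ψ :=
  (hψ.exists_neg_sheet x I_mem_halfDisk neg_I_mem_halfDisk).choose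

theorem rotFun_spec (x : Pole ψ) : (hψ.rotFun x).base = -x.base ∧
    hψ.sheet (hψ.rotFun x) (-Complex.I) = hψ.sheet x Complex.I :=
  (hψ.exists_neg_sheet x I_mem_halfDisk neg_I_mem_halfDisk).choose_spec

/-- The half disk that meets the sheet of `x` along the end of the diameter reached by a
clockwise rotation. -/
noncomputable def rotInv (x : Pole ψ) : Pole ψ :=
  (hψ.exists_neg_sheet x neg_I_mem_halfDisk (by simpa using I_mem_halfDisk)).choose

theorem rotInv_spec (x : Pole ψ) : (hψ.rotInv x).base = -x.base ∧
    hψ.sheet (hψ.rotInv x) Complex.I = hψ.sheet x (-Complex.I) := by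
  have := (hψ.exists_neg_sheet x neg_I_mem_halfDisk (by simpa using I_mem_halfDisk)).choose_spec
  exact ⟨this.1, (congrArg (hψ.sheet (hψ.rotInv x)) (neg_neg Complex.I).symm).trans this.2⟩

/-- Passing to the next half disk in the counterclockwise direction. -/
noncomputable def rot : Equiv.Perm (Pole ψ) where
  toFun := hψ.rotFun
  invFun := hψ.rotInv
  left_inv x := by
    obtain ⟨h1, h2⟩ := hψ.rotFun_spec x
    obtain ⟨h3, h4⟩ := hψ.rotInv_spec (hψ.rotFun x)
    exact hψ.sheet_injective I_mem_halfDisk (by rw [h3, h1, neg_neg]) (h4.trans h2)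
  right_inv x := by
    obtain ⟨h1, h2⟩ := hψ.rotInv_spec x
    obtain ⟨h3, h4⟩ := hψ.rotFun_spec (hψ.rotInv x)
    exact hψ.sheet_injective neg_I_mem_halfDisk (by rw [h3, h1, neg_neg]) (h4.trans h2)

theorem base_rot (x : Pole ψ) : (hψ.rot x).base = -x.base := (hψ.rotFun_spec x).1

theorem sheet_rot_neg_I (x : Pole ψ) :
    hψ.sheet (hψ.rot x) (-Complex.I) = hψ.sheet x Complex.I := (hψ.rotFun_spec x).2

theorem eq_flip {x y : Pole ψ} (hb : y.base = -x.base) (h : hψ.sheet y 0 = hψ.sheet x 0) :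
    y = hψ.flip x :=
  hψ.sheet_injective zero_mem_halfDisk (hb.trans (hψ.base_flip x).symm)
    (h.trans (hψ.sheet_flip_zero x).symm)

/-- Agreement at 0 spreads over the whole interval between the two removed points, by uniqueness of
lifts. -/
theorem sheet_flip (x : Pole ψ) {t : ℝ} (ht : |t| < 1 / 2) :
    hψ.sheet (hψ.flip x) (-(t * Complex.I)) = hψ.sheet x (t * Complex.I) := by
  have hm : ∀ t ∈ Ioo (-(1 / 2) : ℝ) (1 / 2), (t * Complex.I : ℂ) ∈ halfDisk := fun t ht => by
    have := abs_lt.mpr ht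
    exact ofReal_mul_I_mem_halfDisk (by linarith) (by linarith)
  have hm' : ∀ t ∈ Ioo (-(1 / 2) : ℝ) (1 / 2), -(t * Complex.I : ℂ) ∈ halfDisk := fun t ht => by
    have := hm (-t) ⟨by linarith [ht.2], by linarith [ht.1]⟩
    simpa using this
  refine (hψ.eq_sheet (hψ.flip x) (isPreconnected_Ioo (a := (-(1 / 2) : ℝ)) (b := 1 / 2))
    (F := fun t : ℝ => hψ.sheet x (t * Complex.I)) (g := fun t : ℝ => -(t * Complex.I))
    ((hψ.continuousOn_sheet x).comp (by fun_prop) hm) (by fun_prop) hm' (fun t ht => ?_)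
    (y₀ := 0) (by norm_num) ?_ (abs_lt.mp ht)).symm
  · rw [hψ.apply_sheet x (hm t ht), hψ.base_flip]
    ring
  · simp [hψ.sheet_flip_zero]

theorem sheet_rot (x : Pole ψ) {t : ℝ} (ht : 1 / 2 < t) (ht1 : t ≤ 1) :
    hψ.sheet (hψ.rot x) (-(t * Complex.I)) = hψ.sheet x (t * Complex.I) := by
  have hm : ∀ t ∈ Ioc (1 / 2 : ℝ) 1, (t * Complex.I : ℂ) ∈ halfDisk := fun t ht => by
    have := abs_of_pos (show 0 < t by linarith [ht.1])
    exact ofReal_mul_I_mem_halfDisk (by linarith [ht.2]) (by linarith [ht.1])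
  have hm' : ∀ t ∈ Ioc (1 / 2 : ℝ) 1, -(t * Complex.I : ℂ) ∈ halfDisk := fun t ht => by
    have := abs_of_pos (show 0 < t by linarith [ht.1])
    have := ofReal_mul_I_mem_halfDisk (t := -t) (by rw [abs_neg]; linarith [ht.2])
      (by rw [abs_neg]; linarith [ht.1])
    simpa using this
  refine (hψ.eq_sheet (hψ.rot x) (isPreconnected_Ioc (a := (1 / 2 : ℝ)) (b := 1))
    (F := fun t : ℝ => hψ.sheet x (t * Complex.I)) (g := fun t : ℝ => -(t * Complex.I))
    ((hψ.continuousOn_sheet x).comp (by fun_prop) hm) (by fun_prop) hm' (fun t ht => ?_)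
    (y₀ := 1) (by norm_num) ?_ ⟨ht, ht1⟩).symm
  · rw [hψ.apply_sheet x (hm t ht), hψ.base_rot]
    ring
  · simp [hψ.sheet_rot_neg_I]

end DiskCover

/-- Logarithms of the points of the annulus `1/2 < |z| ≤ 1`. -/
def collar : Set ℂ := {l | -Real.log 2 < l.re ∧ l.re ≤ 0}

/-- Logarithms of the points of the punctured disk `0 < |z| < 1/2`. -/
def logHalfBall : Set ℂ := {l | l.re < -Real.log 2}

theorem convex_collar : Convex ℝ collar :=
  (convex_halfSpace_re_gt (-Real.log 2)).inter (convex_halfSpace_re_le 0)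

theorem convex_logHalfBall : Convex ℝ logHalfBall := convex_halfSpace_re_lt (-Real.log 2)

theorem exp_neg_log_two : Real.exp (-Real.log 2) = 1 / 2 := by
  rw [Real.exp_neg, Real.exp_log (by norm_num)]
  norm_num

theorem norm_exp_le_one_of_mem_collar {l : ℂ} (hl : l ∈ collar) : ‖Complex.exp l‖ ≤ 1 := by
  rw [Complex.norm_exp]
  exact Real.exp_le_one_iff.mpr hl.2

theorem half_lt_norm_exp_of_mem_collar {l : ℂ} (hl : l ∈ collar) :
    1 / 2 < ‖Complex.exp l‖ := by
  rw [Complex.norm_exp, ← exp_neg_log_two]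
  exact Real.exp_lt_exp.mpr hl.1

theorem norm_exp_lt_half {l : ℂ} (hl : l ∈ logHalfBall) : ‖Complex.exp l‖ < 1 / 2 := by
  rw [Complex.norm_exp, ← exp_neg_log_two]
  exact Real.exp_lt_exp.mpr hl

theorem mem_logHalfBall_of_norm_exp_lt {l : ℂ} (hl : ‖Complex.exp l‖ < 1 / 2) :
    l ∈ logHalfBall := by
  rwa [Complex.norm_exp, ← exp_neg_log_two, Real.exp_lt_exp] at hl

theorem ofReal_mul_I_mem_collar (t : ℝ) : (t * Complex.I : ℂ) ∈ collar := by
  simp [collar, Real.log_pos]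

theorem zero_mem_collar : (0 : ℂ) ∈ collar := by
  simp [collar, Real.log_pos]

theorem mem_unbranchedDisk_of_norm_ne {z : ℂ} (h1 : ‖z‖ ≤ 1) (h2 : ‖z‖ ≠ 1 / 2) :
    z ∈ unbranchedDisk := by
  refine ⟨h1, fun e => ?_, fun e => ?_⟩ <;>
  · rw [e] at h2
    norm_num at h2

theorem exp_mem_halfDisk {l : ℂ} (hl : l ∈ collar) (h : |l.im| ≤ Real.pi / 2) :
    Complex.exp l ∈ halfDisk := by
  refine mem_halfDisk_of_norm_ne (norm_exp_le_one_of_mem_collar hl) ?_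
    (half_lt_norm_exp_of_mem_collar hl).ne'
  rw [Complex.exp_re]
  have := Real.cos_nonneg_of_mem_Icc (x := l.im) ⟨by linarith [(abs_le.mp h).1], (abs_le.mp h).2⟩
  positivity

/-- Here `w` is a coordinate centered at a branch point: `w = 0` gives one branch point and `w = 1`
the other. The bound 1/2 excludes the second and keeps the modulus at most 1. -/
theorem I_mul_half_sub_mem_unbranchedDisk {s w : ℂ} (hs : s = Complex.I ∨ s = -Complex.I)
    (h0 : w ≠ 0) (hw : ‖w‖ < 1 / 2) : s * (Complex.I * (1 / 2 - w)) ∈ unbranchedDisk := by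
  have h1 : w ≠ 1 := fun e => by rw [e] at hw; norm_num at hw
  have hn : ‖(1 / 2 : ℂ) - w‖ ≤ 1 := by
    refine (norm_sub_le _ _).trans ?_
    norm_num
    linarith
  have hI := Complex.I_mul_I
  rcases hs with rfl | rfl
  · refine ⟨by simpa using hn, fun e => h1 ?_, fun e => h0 ?_⟩
    · linear_combination e - (1 / 2 - w) * hI
    · linear_combination e - (1 / 2 - w) * hI
  · refine ⟨by simpa using hn, fun e => h0 ?_, fun e => h1 ?_⟩
    · linear_combination -e - (1 / 2 - w) * hI
    · linear_combination -e - (1 / 2 - w) * hI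

theorem I_mul_half_sub_mem_halfDisk {w : ℂ} (h0 : w ≠ 0) (hw : ‖w‖ < 1 / 2) (hi : 0 ≤ w.im) :
    Complex.I * (1 / 2 - w) ∈ halfDisk := by
  have h1 : w ≠ 1 := fun e => by rw [e] at hw; norm_num at hw
  have hn : ‖(1 / 2 : ℂ) - w‖ ≤ 1 := by
    refine (norm_sub_le _ _).trans ?_
    norm_num
    linarith
  refine ⟨by simpa using hn, by simpa using hi, fun e => h0 ?_, fun e => h1 ?_⟩
  · linear_combination Complex.I * e - (1 / 2 - w - 1 / 2) * Complex.I_mul_I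
  · linear_combination Complex.I * e - (1 / 2 - w + 1 / 2) * Complex.I_mul_I

theorem neg_I_mul_half_add_mem_halfDisk {w : ℂ} (h0 : w ≠ 0) (hw : ‖w‖ < 1 / 2)
    (hi : 0 ≤ w.im) : -(Complex.I * (1 / 2 + w)) ∈ halfDisk := by
  have h1 : w ≠ -1 := fun e => by rw [e] at hw; norm_num at hw
  have hn : ‖(1 / 2 : ℂ) + w‖ ≤ 1 := by
    refine (norm_add_le _ _).trans ?_
    norm_num
    linarith
  refine ⟨by simpa using hn, by simpa using hi, fun e => h1 ?_, fun e => h0 ?_⟩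
  · linear_combination Complex.I * e + (1 / 2 + w + 1 / 2) * Complex.I_mul_I
  · linear_combination Complex.I * e + (1 / 2 + w - 1 / 2) * Complex.I_mul_I

namespace DiskCover

variable {ψ : Disk → ℂ} (hψ : DiskCover ψ)
include hψ

/-! ### Polar coordinates near the boundary -/

theorem exists_polar (x : Pole ψ) : ∃ F : ℂ → Disk, ContinuousOn F collar ∧
    (∀ l ∈ collar, ψ (F l) = x.base * Complex.exp l) ∧ F 0 = x.1 :=
  hψ.exists_lift (convex_collar.starConvex zero_mem_collar) zero_mem_collar
    (by fun_prop) (fun l hl => mem_unbranchedDisk_of_norm_ne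
      (by rw [norm_mul, x.norm_base, one_mul]; exact norm_exp_le_one_of_mem_collar hl)
      (by rw [norm_mul, x.norm_base, one_mul]; exact (half_lt_norm_exp_of_mem_collar hl).ne'))
    (by simp [Pole.base])

/-- Polar coordinates near the boundary, with the point `x` over `±i` as origin. -/
noncomputable def polar (x : Pole ψ) : ℂ → Disk := (hψ.exists_polar x).choose

theorem continuousOn_polar (x : Pole ψ) : ContinuousOn (hψ.polar x) collar :=
  (hψ.exists_polar x).choose_spec.1

theorem apply_polar (x : Pole ψ) {l : ℂ} (hl : l ∈ collar) :
    ψ (hψ.polar x l) = x.base * Complex.exp l :=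
  (hψ.exists_polar x).choose_spec.2.1 l hl

theorem polar_zero (x : Pole ψ) : hψ.polar x 0 = x.1 := (hψ.exists_polar x).choose_spec.2.2

theorem eq_polar (x : Pole ψ) {Y : Type} [TopologicalSpace Y] {K : Set Y} (hK : IsPreconnected K)
    {F : Y → Disk} {g : Y → ℂ} (hF : ContinuousOn F K) (hg : ContinuousOn g K)
    (hgK : ∀ y ∈ K, g y ∈ collar) (h : ∀ y ∈ K, ψ (F y) = x.base * Complex.exp (g y)) {y₀ : Y}
    (hy₀ : y₀ ∈ K) (h₀ : F y₀ = hψ.polar x (g y₀)) {y : Y} (hy : y ∈ K) :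
    F y = hψ.polar x (g y) :=
  hψ.eqOn_of_lifts hK hF ((hψ.continuousOn_polar x).comp hg hgK)
    (fun y hy => by rw [h y hy, Function.comp_apply, hψ.apply_polar x (hgK y hy)])
    (fun y hy => by
      rw [h y hy]
      refine mem_unbranchedDisk_of_norm_ne ?_ ?_ <;> rw [norm_mul, x.norm_base, one_mul]
      · exact norm_exp_le_one_of_mem_collar (hgK y hy)
      · exact (half_lt_norm_exp_of_mem_collar (hgK y hy)).ne') hy₀ h₀ hy

theorem polar_eq_sheet (x : Pole ψ) {l : ℂ} (hl : l ∈ collar) (h : |l.im| ≤ Real.pi / 2) :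
    hψ.polar x l = hψ.sheet x (Complex.exp l) := by
  let K : Set ℂ := collar ∩ {l | |l.im| ≤ Real.pi / 2}
  have hK : Convex ℝ K := by
    have : K = collar ∩ ({l | -(Real.pi / 2) ≤ l.im} ∩ {l | l.im ≤ Real.pi / 2}) := by
      ext l
      simp [K, abs_le]
    rw [this]
    exact convex_collar.inter ((convex_halfSpace_im_ge _).inter (convex_halfSpace_im_le _))
  exact hψ.eq_sheet x hK.isPreconnected ((hψ.continuousOn_polar x).mono inter_subset_left)
    (by fun_prop) (fun l hl => exp_mem_halfDisk hl.1 hl.2)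
    (fun l hl => hψ.apply_polar x hl.1) (y₀ := 0)
    ⟨zero_mem_collar, by simpa using Real.pi_div_two_pos.le⟩
    (by rw [hψ.polar_zero, Complex.exp_zero, hψ.sheet_one]) ⟨hl, h⟩

omit hψ in
theorem add_ofReal_mul_I_mem_collar {l : ℂ} (hl : l ∈ collar) (t : ℝ) :
    l + t * Complex.I ∈ collar := by
  simpa [collar] using hl

/-- A half turn changes the sign of the base, as `rot` does. The two lifts are compared at the angle
−π/2, where they take the value at i in the sheet of `x` and at −i in that of `rot x`; these are
equal by the choice of `rot`. -/
theorem polar_add_pi (x : Pole ψ) {l : ℂ} (hl : l ∈ collar) :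
    hψ.polar x (l + Real.pi * Complex.I) = hψ.polar (hψ.rot x) l := by
  refine hψ.eq_polar (hψ.rot x) convex_collar.isPreconnected
    (F := fun l => hψ.polar x (l + Real.pi * Complex.I)) (g := fun l => l)
    ((hψ.continuousOn_polar x).comp (by fun_prop) fun l hl => add_ofReal_mul_I_mem_collar hl _)
    (by fun_prop) (fun l hl => hl) (fun l hl => ?_)
    (y₀ := ((-(Real.pi / 2) : ℝ) : ℂ) * Complex.I) (ofReal_mul_I_mem_collar _) ?_ hl
  · rw [hψ.apply_polar x (add_ofReal_mul_I_mem_collar hl _), hψ.base_rot, Complex.exp_add,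
      Complex.exp_pi_mul_I]
    ring
  · have e : ((-(Real.pi / 2) : ℝ) : ℂ) * Complex.I + Real.pi * Complex.I =
        ((Real.pi / 2 : ℝ) : ℂ) * Complex.I := by
      push_cast
      ring
    rw [e, hψ.polar_eq_sheet x (ofReal_mul_I_mem_collar _) (by simp [abs_of_pos Real.pi_div_two_pos]),
      hψ.polar_eq_sheet _ (ofReal_mul_I_mem_collar _) (by simp [abs_of_pos Real.pi_div_two_pos])]
    push_cast
    rw [Complex.exp_pi_div_two_mul_I, neg_mul, Complex.exp_neg, Complex.exp_pi_div_two_mul_I,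
      Complex.inv_I, hψ.sheet_rot_neg_I]

theorem polar_add_int_mul_pi (x : Pole ψ) (k : ℤ) {l : ℂ} (hl : l ∈ collar) :
    hψ.polar x (l + k * Real.pi * Complex.I) = hψ.polar ((hψ.rot ^ k) x) l := by
  induction k using Int.induction_on generalizing x with
  | zero => simp
  | succ n ih =>
    have e : l + ((n + 1 : ℤ) : ℂ) * Real.pi * Complex.I =
        (l + ((n : ℤ) : ℂ) * Real.pi * Complex.I) + Real.pi * Complex.I := by
      push_cast
      ring
    have hl' : l + ((n : ℤ) : ℂ) * Real.pi * Complex.I ∈ collar := by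
      simpa using add_ofReal_mul_I_mem_collar hl (n * Real.pi)
    rw [e, hψ.polar_add_pi x hl', ih, zpow_add_one]
    rfl
  | pred n ih =>
    have hl' : l + ((-(n : ℤ) - 1 : ℤ) : ℂ) * Real.pi * Complex.I ∈ collar := by
      have := add_ofReal_mul_I_mem_collar hl ((-(n : ℤ) - 1 : ℤ) * Real.pi)
      push_cast at this ⊢
      exact this
    have e : l + ((-(n : ℤ) - 1 : ℤ) : ℂ) * Real.pi * Complex.I + Real.pi * Complex.I =
        l + ((-(n : ℤ) : ℤ) : ℂ) * Real.pi * Complex.I := by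
      push_cast
      ring
    have h1 := hψ.polar_add_pi (hψ.rot⁻¹ x) hl'
    rw [e, ih] at h1
    rw [zpow_sub_one]
    simpa using h1.symm

theorem norm_pole (x : Pole ψ) : ‖(x.1 : ℂ)‖ = 1 :=
  (hψ.norm_eq_one_iff x.1).mp x.norm_base

/-- The boundary of the covering disk is connected, so a boundary arc leads from `x` to `y`. Along
it the image moves on the unit circle by a continuous angle, and the total angle nπ gives the power
of `rot`. -/
theorem exists_rot_zpow_eq (x y : Pole ψ) : ∃ n : ℤ, (hψ.rot ^ n) x = y := by
  have hcirc : ∀ z : Disk, ‖(z : ℂ)‖ = 1 → ∃ θ : ℝ, circlePoint θ = z := fun z hz =>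
    ⟨(z : ℂ).arg, Subtype.ext (by
      have := Complex.norm_mul_exp_arg_mul_I (z : ℂ)
      rwa [hz, Complex.ofReal_one, one_mul] at this)⟩
  have hψc : ∀ θ, ‖ψ (circlePoint θ)‖ = 1 := fun θ =>
    (hψ.norm_eq_one_iff _).mpr (Complex.norm_exp_ofReal_mul_I θ)
  obtain ⟨θ₀, h₀⟩ := hcirc x.1 (hψ.norm_pole x)
  obtain ⟨θ₁, h₁⟩ := hcirc y.1 (hψ.norm_pole y)
  obtain ⟨μ, hμc, hμ, hμ0⟩ := Complex.exists_continuousOn_log (K := (univ : Set ℝ)) (c := θ₀)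
    (f := fun θ => ψ (circlePoint θ) / x.base) (l := 0) (convex_univ.starConvex (mem_univ _))
    (mem_univ _) ((hψ.continuous.comp continuous_circlePoint).div_const _).continuousOn
    (fun θ _ => div_ne_zero (norm_ne_zero_iff.mp (by rw [hψc]; exact one_ne_zero))
      x.base_ne_zero) (by
      rw [h₀, Complex.exp_zero]
      exact (div_self x.base_ne_zero).symm)
  have hre : ∀ θ, (μ θ).re = 0 := fun θ => by
    have := congrArg norm (hμ θ (mem_univ _))
    rw [norm_div, hψc, x.norm_base, Complex.norm_exp, div_one, Real.exp_eq_one_iff] at this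
    exact this
  have hcol : ∀ θ, μ θ ∈ collar := fun θ => by
    simp [collar, hre, Real.log_pos]
  have key := hψ.eq_polar x (isPreconnected_univ (α := ℝ)) (F := circlePoint) (g := μ)
    continuous_circlePoint.continuousOn hμc (fun θ _ => hcol θ)
    (fun θ _ => by rw [hμ θ (mem_univ _), mul_div_cancel₀ _ x.base_ne_zero]) (mem_univ θ₀)
    (by rw [hμ0, hψ.polar_zero, h₀]) (mem_univ θ₁)
  -- Both ends lie over ±i, so the quotient of their images is ±1. Squaring removes the sign and
  -- makes `μ θ₁` an integer multiple of πi.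
  have hsq : Complex.exp (2 * μ θ₁) = 1 := by
    rw [two_mul, Complex.exp_add, hμ θ₁ (mem_univ _), h₁]
    have hb := x.base_ne_zero
    rcases x.base_eq_or y with h | h <;>
    · change y.base / x.base * (y.base / x.base) = 1
      rw [h]
      field_simp
  obtain ⟨n, hn⟩ := Complex.exp_eq_one_iff.mp hsq
  refine ⟨n, Subtype.ext ?_⟩
  have hn' : μ θ₁ = 0 + n * Real.pi * Complex.I := by linear_combination hn / 2
  rw [← hψ.polar_zero, ← hψ.polar_add_int_mul_pi x n zero_mem_collar, ← hn', ← key, h₁]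

/-- Every point `q` of the unit circle lies in the upper or lower half disk. The sheets over that
half correspond to the points over `q`, and `rot` exchanges the poles over i with those over −i. The
point `q` is arbitrary because the base point of the generators may be anywhere on the circle in the
twist's coordinates. -/
theorem card_pole {q : ℂ} (hq : ‖q‖ = 1) : Nat.card (Pole ψ) = 2 * Nat.card {y // ψ y = q} := by
  obtain ⟨s, hs, z, hz, hsz⟩ : ∃ s, (s = Complex.I ∨ s = -Complex.I) ∧ ∃ z ∈ halfDisk,
      s * z = q := by
    have hI := Complex.I_mul_I
    rcases le_total 0 q.im with h | h
    · exact ⟨Complex.I, .inl rfl, -Complex.I * q,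
        mem_halfDisk_of_norm_ne (by simp [hq]) (by simpa using h) (by simp [hq]),
        by linear_combination -q * hI⟩
    · exact ⟨-Complex.I, .inr rfl, Complex.I * q,
        mem_halfDisk_of_norm_ne (by simp [hq]) (by simpa using h) (by simp [hq]),
        by linear_combination -q * hI⟩
  have e1 : Nat.card {x : Pole ψ // x.base = s} = Nat.card {y // ψ y = q} := by
    refine Nat.card_eq_of_bijective
      (fun x => ⟨hψ.sheet x.1 z, by rw [hψ.apply_sheet _ hz, x.2, hsz]⟩) ⟨?_, ?_⟩
    · rintro ⟨x, hx⟩ ⟨y, hy⟩ h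
      exact Subtype.ext (hψ.sheet_injective hz (hx.trans hy.symm) (congrArg Subtype.val h))
    · rintro ⟨y, hy⟩
      obtain ⟨x, hx, hxy⟩ := hψ.exists_sheet_eq hs hz (hy.trans hsz.symm)
      exact ⟨⟨x, hx⟩, Subtype.ext hxy⟩
  have hiff : ∀ x : Pole ψ, x.base = s ↔ ¬ (hψ.rot x).base = s := by
    intro x
    have hs0 : s ≠ -s := by
      rcases hs with rfl | rfl <;> simp [self_eq_neg, neg_eq_self]
    rw [hψ.base_rot]
    have h2 : x.base = s ∨ x.base = -s := by
      rcases x.base_eq with h | h <;> rcases hs with rfl | rfl <;> simp [h]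
    rcases h2 with h | h
    · rw [h]
      exact ⟨fun _ => hs0.symm, fun _ => rfl⟩
    · rw [h]
      exact ⟨fun e => absurd e.symm hs0, fun e => absurd (neg_neg s) e⟩
  have e2 : Nat.card {x : Pole ψ // ¬ x.base = s} = Nat.card {x : Pole ψ // x.base = s} :=
    (Nat.card_congr (hψ.rot.subtypeEquiv hiff)).symm
  classical
  rcases finite_or_infinite {x : Pole ψ // x.base = s} with hf | hf
  · have hf' : Finite {x : Pole ψ // ¬ x.base = s} :=
      Finite.of_equiv _ (hψ.rot.subtypeEquiv hiff)
    rw [← Nat.card_congr (Equiv.sumCompl fun x : Pole ψ => x.base = s), Nat.card_sum, e2, e1,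
      two_mul]
  -- In the infinite case both cardinalities are 0 by the convention of `Nat.card`.
  · have : Infinite (Pole ψ) := Infinite.of_injective (Subtype.val : {x : Pole ψ // x.base = s} → _)
      Subtype.val_injective
    rw [← e1, Nat.card_eq_zero_of_infinite, Nat.card_eq_zero_of_infinite]

theorem rot_zpow_apply_eq_iff (x : Pole ψ) (n : ℤ) :
    (hψ.rot ^ n) x = x ↔ (Nat.card (Pole ψ) : ℤ) ∣ n := by
  have h1 : Function.minimalPeriod (hψ.rot • · : Pole ψ → Pole ψ) x = Nat.card (Pole ψ) := by
    have huniv : MulAction.orbit (Subgroup.zpowers hψ.rot) x = univ := by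
      refine eq_univ_of_forall fun y => ?_
      obtain ⟨n, hn⟩ := hψ.exists_rot_zpow_eq x y
      exact ⟨⟨hψ.rot ^ n, n, rfl⟩, hn⟩
    have := Nat.card_congr (Equiv.setCongr huniv)
    rw [Nat.card_univ] at this
    rw [← this]
    exact (Nat.card_congr (MulAction.orbitZPowersEquiv hψ.rot x)).trans (Nat.card_zmod _) |>.symm
  rw [← h1, ← MulAction.zpow_smul_eq_iff_minimalPeriod_dvd]
  rfl

end DiskCover

/-! ### Local monodromy -/

/-- Every loop near `q`, run through twice, lifts to closed loops only. -/
def SquareLiftsClosed {X : Type*} [TopologicalSpace X] (f : Disk → X) (q : X) : Prop :=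
  ∃ U ∈ 𝓝 q, ∀ Γ : ℝ → Disk, Continuous Γ → (∀ t, f (Γ t) ∈ U ∧ f (Γ t) ≠ q) →
    (∀ t, f (Γ (t + 1)) = f (Γ t)) → Γ 2 = Γ 0

/-- This is what allows the condition to pass between different coordinates on the disk. -/
theorem squareLiftsClosed_comp_iff {X Y : Type*} [TopologicalSpace X] [TopologicalSpace Y]
    {e : X → Y} (he : IsEmbedding e) {f : Disk → X} {q : X} :
    SquareLiftsClosed (fun x => e (f x)) (e q) ↔ SquareLiftsClosed f q := by
  constructor
  · rintro ⟨U, hU, h⟩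
    exact ⟨e ⁻¹' U, he.continuous.continuousAt hU, fun Γ hΓ h1 h2 =>
      h Γ hΓ (fun t => ⟨(h1 t).1, fun he' => (h1 t).2 (he.injective he')⟩)
        (fun t => congrArg e (h2 t))⟩
  · rintro ⟨U, hU, h⟩
    rw [he.nhds_eq_comap, Filter.mem_comap] at hU
    obtain ⟨V, hV, hVU⟩ := hU
    exact ⟨V, hV, fun Γ hΓ h1 h2 => h Γ hΓ
      (fun t => ⟨hVU (h1 t).1, fun he' => (h1 t).2 (congrArg e he')⟩)
      (fun t => he.injective (h2 t))⟩

/-- The logarithm of `1/4`. -/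
noncomputable def logQuarter : ℝ := Real.log (1 / 4)

theorem exp_logQuarter : Complex.exp (logQuarter : ℂ) = 1 / 4 := by
  rw [← Complex.ofReal_exp, logQuarter, Real.exp_log (by norm_num)]
  norm_num

theorem logQuarter_mem : (logQuarter : ℂ) ∈ logHalfBall := by
  apply mem_logHalfBall_of_norm_exp_lt
  rw [exp_logQuarter]
  norm_num

theorem add_mul_pi_mul_I_mem_logHalfBall {l : ℂ} (hl : l ∈ logHalfBall) (t : ℝ) :
    l + t * Complex.I ∈ logHalfBall := by
  simpa [logHalfBall] using hl

/-! ### Logarithmic coordinates at a branch point -/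

namespace DiskCover

variable {ψ : Disk → ℂ} (hψ : DiskCover ψ)
include hψ

omit hψ in
theorem quarter_mul_I_mem_halfDisk : Complex.I * (1 / 2 - 1 / 4) ∈ halfDisk :=
  I_mul_half_sub_mem_halfDisk (by norm_num) (by norm_num) (by norm_num)

omit hψ in
theorem mapsTo_I_mul_half_sub_exp (x : Pole ψ) :
    MapsTo (fun l => x.base * (Complex.I * (1 / 2 - Complex.exp l))) logHalfBall
      unbranchedDisk := fun _ hl =>
  I_mul_half_sub_mem_unbranchedDisk x.base_eq (Complex.exp_ne_zero _) (norm_exp_lt_half hl)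

theorem exists_localLift (x : Pole ψ) : ∃ F : ℂ → Disk, ContinuousOn F logHalfBall ∧
    (∀ l ∈ logHalfBall, ψ (F l) = x.base * (Complex.I * (1 / 2 - Complex.exp l))) ∧
    F logQuarter = hψ.sheet x (Complex.I * (1 / 2 - 1 / 4)) :=
  hψ.exists_lift (convex_logHalfBall.starConvex logQuarter_mem) logQuarter_mem
    (by fun_prop) (mapsTo_I_mul_half_sub_exp x)
    (by rw [hψ.apply_sheet x quarter_mul_I_mem_halfDisk, exp_logQuarter])

/-- Logarithmic coordinates around a branch point, starting at the sheet of `x`. -/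
noncomputable def localLift (x : Pole ψ) : ℂ → Disk := (hψ.exists_localLift x).choose

theorem continuousOn_localLift (x : Pole ψ) : ContinuousOn (hψ.localLift x) logHalfBall :=
  (hψ.exists_localLift x).choose_spec.1

theorem apply_localLift (x : Pole ψ) {l : ℂ} (hl : l ∈ logHalfBall) :
    ψ (hψ.localLift x l) = x.base * (Complex.I * (1 / 2 - Complex.exp l)) :=
  (hψ.exists_localLift x).choose_spec.2.1 l hl

theorem localLift_logQuarter (x : Pole ψ) :
    hψ.localLift x logQuarter = hψ.sheet x (Complex.I * (1 / 2 - 1 / 4)) :=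
  (hψ.exists_localLift x).choose_spec.2.2

theorem eq_localLift (x : Pole ψ) {Y : Type} [TopologicalSpace Y] {K : Set Y}
    (hK : IsPreconnected K) {F : Y → Disk} {g : Y → ℂ} (hF : ContinuousOn F K)
    (hg : ContinuousOn g K) (hgK : ∀ y ∈ K, g y ∈ logHalfBall)
    (h : ∀ y ∈ K, ψ (F y) = x.base * (Complex.I * (1 / 2 - Complex.exp (g y)))) {y₀ : Y}
    (hy₀ : y₀ ∈ K) (h₀ : F y₀ = hψ.localLift x (g y₀)) {y : Y} (hy : y ∈ K) :
    F y = hψ.localLift x (g y) :=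
  hψ.eqOn_of_lifts hK hF ((hψ.continuousOn_localLift x).comp hg hgK)
    (fun y hy => by rw [h y hy, Function.comp_apply, hψ.apply_localLift x (hgK y hy)])
    (fun y hy => by rw [h y hy]; exact mapsTo_I_mul_half_sub_exp x (hgK y hy)) hy₀ h₀ hy

omit hψ in
theorem convex_upper : Convex ℝ (logHalfBall ∩ {l | 0 ≤ l.im ∧ l.im ≤ Real.pi}) :=
  convex_logHalfBall.inter ((convex_halfSpace_im_ge 0).inter (convex_halfSpace_im_le Real.pi))

omit hψ in
theorem exp_im_nonneg {l : ℂ} (h : 0 ≤ l.im ∧ l.im ≤ Real.pi) : 0 ≤ (Complex.exp l).im := by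
  rw [Complex.exp_im]
  have := Real.sin_nonneg_of_nonneg_of_le_pi h.1 h.2
  positivity

theorem localLift_eq_sheet (x : Pole ψ) {l : ℂ} (hl : l ∈ logHalfBall)
    (h : 0 ≤ l.im ∧ l.im ≤ Real.pi) :
    hψ.localLift x l = hψ.sheet x (Complex.I * (1 / 2 - Complex.exp l)) :=
  hψ.eq_sheet x convex_upper.isPreconnected
    ((hψ.continuousOn_localLift x).mono inter_subset_left)
    (by fun_prop) (fun l hl => I_mul_half_sub_mem_halfDisk (Complex.exp_ne_zero l)
      (norm_exp_lt_half hl.1) (exp_im_nonneg hl.2))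
    (fun l hl => hψ.apply_localLift x hl.1) (y₀ := (logQuarter : ℂ))
    ⟨logQuarter_mem, by simp [Real.pi_pos.le]⟩
    (by rw [hψ.localLift_logQuarter, exp_logQuarter]) ⟨hl, h⟩

/-- Half a turn around the branch point leads to negative `w`, which is the outer end of the
diameter. The lift crosses it into the sheet of `rot x`. -/
theorem localLift_add_pi_eq_sheet (x : Pole ψ) {l : ℂ} (hl : l ∈ logHalfBall)
    (h : 0 ≤ l.im ∧ l.im ≤ Real.pi) :
    hψ.localLift x (l + Real.pi * Complex.I) =
      hψ.sheet (hψ.rot x) (-(Complex.I * (1 / 2 + Complex.exp l))) := by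
  refine hψ.eq_sheet (hψ.rot x) convex_upper.isPreconnected
    (F := fun l => hψ.localLift x (l + Real.pi * Complex.I))
    (g := fun l => -(Complex.I * (1 / 2 + Complex.exp l)))
    ((hψ.continuousOn_localLift x).comp (by fun_prop) fun l hl =>
      add_mul_pi_mul_I_mem_logHalfBall hl.1 _)
    (by fun_prop) (fun l hl => neg_I_mul_half_add_mem_halfDisk (Complex.exp_ne_zero l)
      (norm_exp_lt_half hl.1) (exp_im_nonneg hl.2)) (fun l hl => ?_) (y₀ := (logQuarter : ℂ))
    ⟨logQuarter_mem, by simp [Real.pi_pos.le]⟩ ?_ ⟨hl, h⟩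
  · rw [hψ.apply_localLift x (add_mul_pi_mul_I_mem_logHalfBall hl.1 _), hψ.base_rot,
      Complex.exp_add, Complex.exp_pi_mul_I]
    ring
  · rw [hψ.localLift_eq_sheet x (add_mul_pi_mul_I_mem_logHalfBall logQuarter_mem _)
      (by simp [Real.pi_pos.le]), Complex.exp_add, Complex.exp_pi_mul_I, exp_logQuarter]
    -- At `w = -1/4` the point of the diameter is 1/2 + 1/4 = 3/4.
    have := hψ.sheet_rot x (t := 3 / 4) (by norm_num) (by norm_num)
    convert this.symm using 2 <;>
    · push_cast
      ring

/-- The local monodromy around a branch point. -/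
noncomputable def turn : Equiv.Perm (Pole ψ) := hψ.flip * hψ.rot

theorem base_turn (x : Pole ψ) : (hψ.turn x).base = x.base := by
  simp [turn, hψ.base_flip, hψ.base_rot]

theorem base_turn_zpow (x : Pole ψ) (n : ℤ) : ((hψ.turn ^ n) x).base = x.base := by
  induction n using Int.induction_on generalizing x with
  | zero => simp
  | succ n ih => rw [zpow_add_one, Equiv.Perm.mul_apply, ih, hψ.base_turn]
  | pred n ih =>
    rw [zpow_sub_one, Equiv.Perm.mul_apply, ih, ← hψ.base_turn]
    simp

/-- The first half turn crosses the outer end (`rot`), the second returns to positive `w` and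
crosses the middle segment (`flip`). -/
theorem localLift_add_two_pi (x : Pole ψ) {l : ℂ} (hl : l ∈ logHalfBall) :
    hψ.localLift x (l + 2 * Real.pi * Complex.I) = hψ.localLift (hψ.turn x) l := by
  have hmem : ∀ l ∈ logHalfBall, l + 2 * Real.pi * Complex.I ∈ logHalfBall := fun l hl => by
    have := add_mul_pi_mul_I_mem_logHalfBall hl (2 * Real.pi)
    push_cast at this
    exact this
  refine hψ.eq_localLift (hψ.turn x) convex_logHalfBall.isPreconnected
    (F := fun l => hψ.localLift x (l + 2 * Real.pi * Complex.I)) (g := fun l => l)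
    ((hψ.continuousOn_localLift x).comp (by fun_prop) hmem)
    (by fun_prop) (fun l hl => hl) (fun l hl => ?_) (y₀ := (logQuarter : ℂ)) logQuarter_mem ?_ hl
  · rw [hψ.apply_localLift x (hmem l hl), hψ.base_turn, Complex.exp_add,
      Complex.exp_two_pi_mul_I, mul_one]
  · have e : (logQuarter : ℂ) + 2 * Real.pi * Complex.I =
        (logQuarter + Real.pi * Complex.I) + Real.pi * Complex.I := by ring
    rw [e, hψ.localLift_add_pi_eq_sheet x (add_mul_pi_mul_I_mem_logHalfBall logQuarter_mem _)
      (by simp [Real.pi_pos.le]), Complex.exp_add, Complex.exp_pi_mul_I, exp_logQuarter,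
      hψ.localLift_logQuarter]
    change _ = hψ.sheet (hψ.flip (hψ.rot x)) _
    have := hψ.sheet_flip (hψ.rot x) (t := -(1 / 4)) (by rw [abs_neg, abs_of_pos] <;> norm_num)
    convert this.symm using 2 <;>
    · push_cast
      ring

theorem localLift_add_int_mul_two_pi (x : Pole ψ) (k : ℤ) {l : ℂ} (hl : l ∈ logHalfBall) :
    hψ.localLift x (l + k * (2 * Real.pi * Complex.I)) =
      hψ.localLift ((hψ.turn ^ k) x) l := by
  have hmem : ∀ k : ℤ, l + k * (2 * Real.pi * Complex.I) ∈ logHalfBall := fun k => by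
    have := add_mul_pi_mul_I_mem_logHalfBall hl (k * (2 * Real.pi))
    push_cast at this
    rwa [mul_assoc] at this
  induction k using Int.induction_on generalizing x with
  | zero => simp
  | succ n ih =>
    have e : l + ((n + 1 : ℤ) : ℂ) * (2 * Real.pi * Complex.I) =
        (l + ((n : ℤ) : ℂ) * (2 * Real.pi * Complex.I)) + 2 * Real.pi * Complex.I := by
      push_cast
      ring
    rw [e, hψ.localLift_add_two_pi x (hmem n), ih, zpow_add_one]
    rfl
  | pred n ih =>
    have e : l + ((-(n : ℤ) - 1 : ℤ) : ℂ) * (2 * Real.pi * Complex.I) + 2 * Real.pi * Complex.I =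
        l + ((-(n : ℤ) : ℤ) : ℂ) * (2 * Real.pi * Complex.I) := by
      push_cast
      ring
    have h1 := hψ.localLift_add_two_pi (hψ.turn⁻¹ x) (hmem (-(n : ℤ) - 1))
    rw [e, ih] at h1
    rw [zpow_sub_one]
    simpa using h1.symm

theorem exists_localLift_eq {y : Disk} {s l : ℂ} (hs : s = Complex.I ∨ s = -Complex.I)
    (hl : l ∈ logHalfBall) (hy : ψ y = s * (Complex.I * (1 / 2 - Complex.exp l))) :
    ∃ x : Pole ψ, x.base = s ∧ hψ.localLift x l = y := by
  obtain ⟨F, hF, hFv, hFl⟩ := hψ.exists_lift (convex_logHalfBall.starConvex hl) hl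
    (f := fun l => s * (Complex.I * (1 / 2 - Complex.exp l))) (by fun_prop)
    (fun l hl => I_mul_half_sub_mem_unbranchedDisk hs (Complex.exp_ne_zero _)
      (norm_exp_lt_half hl)) hy
  obtain ⟨x, hx, hxF⟩ := hψ.exists_sheet_eq hs quarter_mul_I_mem_halfDisk
    (y := F logQuarter) (by rw [hFv _ logQuarter_mem, exp_logQuarter])
  refine ⟨x, hx, ?_⟩
  rw [← hFl]
  refine (hψ.eq_localLift x convex_logHalfBall.isPreconnected hF continuousOn_id
    (fun l hl => hl) (fun l hl => by rw [hFv l hl, hx]; rfl) logQuarter_mem ?_ hl).symm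
  rw [id, hψ.localLift_logQuarter, hxF]

/-- In the coordinate `w`, the logarithm along a loop grows by 2πi·n in one period, hence by 2πi·2n
in two. Its lift therefore changes by the even power `turn ^ (2n)`, which is trivial. -/
theorem squareLiftsClosed_of_turn {s : ℂ} (hs : s = Complex.I ∨ s = -Complex.I)
    (h : ∀ x : Pole ψ, x.base = s → hψ.turn (hψ.turn x) = x) :
    SquareLiftsClosed ψ (s * (Complex.I * (1 / 2))) := by
  have hns : ‖s‖ = 1 := by rcases hs with rfl | rfl <;> simp
  have hs2 : s * s = -1 := by
    rcases hs with rfl | rfl <;> simp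
  refine ⟨Metric.ball _ (1 / 2), Metric.ball_mem_nhds _ (by norm_num), fun Γ hΓ h1 h2 => ?_⟩
  let w : ℝ → ℂ := fun t => 1 / 2 - ψ (Γ t) * s * Complex.I
  have hw : ∀ t, ψ (Γ t) = s * (Complex.I * (1 / 2 - w t)) := fun t => by
    simp only [w]
    linear_combination (-ψ (Γ t) * s ^ 2) * Complex.I_mul_I + ψ (Γ t) * hs2
  have hwc : Continuous w := by
    have := hψ.continuous.comp hΓ
    exact continuous_const.sub ((this.mul continuous_const).mul continuous_const)
  have hw0 : ∀ t, w t ≠ 0 := fun t e => (h1 t).2 (by rw [hw, e, sub_zero])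
  have hwn : ∀ t, ‖w t‖ < 1 / 2 := fun t => by
    have := (h1 t).1
    rw [mem_ball_iff_norm, hw] at this
    have e : s * (Complex.I * (1 / 2 - w t)) - s * (Complex.I * (1 / 2)) =
      s * (Complex.I * (-w t)) := by ring
    rwa [e, norm_mul, norm_mul, hns, Complex.norm_I, one_mul, one_mul, norm_neg] at this
  have hwp : ∀ t, w (t + 1) = w t := fun t => by simp only [w, h2]
  obtain ⟨L, hLc, hL, -⟩ := Complex.exists_continuousOn_log (K := (univ : Set ℝ)) (c := 0)
    (convex_univ.starConvex (mem_univ _)) (mem_univ _) hwc.continuousOn (fun t _ => hw0 t)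
    (Complex.exp_log (hw0 0))
  rw [continuousOn_univ] at hLc
  have hLe : ∀ t, Complex.exp (L t) = w t := fun t => hL t (mem_univ _)
  have hLm : ∀ t, L t ∈ logHalfBall := fun t =>
    mem_logHalfBall_of_norm_exp_lt (by rw [hLe]; exact hwn t)
  obtain ⟨n, hn⟩ := Complex.exp_eq_exp_iff_exists_int.mp
    (show Complex.exp (L 1) = Complex.exp (L 0) by rw [hLe, hLe, ← hwp 0, zero_add])
  -- The increment found between 0 and 1 is the same over every unit interval, in particular between
  -- 1 and 2.
  have hstep := Complex.eqOn_add_of_exp_eq (K := (univ : Set ℝ)) isPreconnected_univ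
    (F := fun t => L (t + 1)) (G := L) (d := n * (2 * Real.pi * Complex.I)) (y₀ := 0)
    (hLc.comp (continuous_id.add continuous_const)).continuousOn hLc.continuousOn
    (fun t _ => by rw [hLe, hLe, hwp]) (mem_univ _) (by simp only [zero_add, hn])
  have hL2 : L 2 = L 0 + ((n + n : ℤ) : ℂ) * (2 * Real.pi * Complex.I) := by
    have := hstep 1 (mem_univ _)
    rw [hn] at this
    norm_num at this
    rw [this]
    push_cast
    ring
  obtain ⟨x, hx, hx0⟩ := hψ.exists_localLift_eq hs (hLm 0) (y := Γ 0) (by rw [hLe, hw])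
  have key : ∀ t, Γ t = hψ.localLift x (L t) := fun t =>
    hψ.eq_localLift x isPreconnected_univ hΓ.continuousOn hLc.continuousOn (fun t _ => hLm t)
      (fun t _ => by rw [hLe, hx, hw]) (mem_univ (0 : ℝ)) hx0.symm (mem_univ t)
  have hpow : ∀ n : ℤ, ∀ x : Pole ψ, x.base = s → (hψ.turn ^ (n + n)) x = x := by
    intro n x hx
    have h3 : (hψ.turn ^ (2 : ℤ)) x = x := h x hx
    have := Function.IsFixedPt.perm_zpow h3 n
    rwa [← zpow_mul, two_mul] at this
  rw [key 2, hL2, hψ.localLift_add_int_mul_two_pi x _ (hLm 0), hpow n x hx, hx0]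

/-- The condition is tested on a small circle around the branch point, whose lift in logarithmic
coordinates realizes `turn`. -/
theorem turn_turn_of_squareLiftsClosed {x : Pole ψ}
    (h : SquareLiftsClosed ψ (x.base * (Complex.I * (1 / 2)))) :
    hψ.turn (hψ.turn x) = x := by
  obtain ⟨U, hU, h⟩ := h
  obtain ⟨ε, hε, hεU⟩ := Metric.mem_nhds_iff.mp hU
  set r : ℝ := Real.log (min (ε / 2) (1 / 4)) with hr
  have hr1 : Real.exp r = min (ε / 2) (1 / 4) := Real.exp_log (by positivity)
  have hrn : ∀ t : ℝ, ‖Complex.exp (r + t * (2 * Real.pi * Complex.I))‖ = min (ε / 2) (1 / 4) :=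
    fun t => by
      rw [Complex.norm_exp, ← hr1]
      congr 1
      simp
  have hmem : ∀ t : ℝ, (r + t * (2 * Real.pi * Complex.I) : ℂ) ∈ logHalfBall := fun t =>
    mem_logHalfBall_of_norm_exp_lt (by
      rw [hrn]
      exact (min_le_right _ _).trans_lt (by norm_num))
  have hr0 : (r : ℂ) ∈ logHalfBall := by simpa using hmem 0
  have hval := fun t => hψ.apply_localLift x (hmem t)
  have key := h (fun t : ℝ => hψ.localLift x (r + t * (2 * Real.pi * Complex.I)))
    ((hψ.continuousOn_localLift x).comp_continuous (by fun_prop) hmem) (fun t => ?_) (fun t => ?_)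
  · have e2 : ((2 : ℝ) : ℂ) = ((2 : ℤ) : ℂ) := by norm_num
    rw [e2, hψ.localLift_add_int_mul_two_pi x 2 hr0, Complex.ofReal_zero, zero_mul, add_zero,
      hψ.localLift_eq_sheet _ hr0 (by simp [Real.pi_pos.le]),
      hψ.localLift_eq_sheet _ hr0 (by simp [Real.pi_pos.le])] at key
    exact hψ.sheet_injective (I_mul_half_sub_mem_halfDisk (Complex.exp_ne_zero _)
      (norm_exp_lt_half hr0) (exp_im_nonneg (by simp [Real.pi_pos.le])))
      (hψ.base_turn_zpow x 2) key
  · rw [hval]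
    constructor
    · apply hεU
      rw [mem_ball_iff_norm]
      have e : ∀ w : ℂ, x.base * (Complex.I * (1 / 2 - w)) - x.base * (Complex.I * (1 / 2)) =
        x.base * (Complex.I * (-w)) := fun w => by ring
      rw [e, norm_mul, norm_mul, x.norm_base, Complex.norm_I, one_mul, one_mul, norm_neg, hrn]
      exact (min_le_left _ _).trans_lt (by linarith)
    · intro e
      have e1 := mul_left_cancel₀ Complex.I_ne_zero (mul_left_cancel₀ x.base_ne_zero e)
      exact Complex.exp_ne_zero _ (by linear_combination -e1)
  · rw [hval, hval]
    congr 3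
    rw [Complex.exp_eq_exp_iff_exists_int]
    exact ⟨1, by push_cast; ring⟩

end DiskCover

namespace DiskCover

variable {ψ : Disk → ℂ} (hψ : DiskCover ψ)
include hψ

/-! ### Lifting the standard loops -/

/-- The lift from 1 to −1 runs through the sheet of `x` down to 0 and then through that of `flip x`,
which shares the point over 0. -/
theorem exists_diameter_lift (x : Pole ψ) : ∃ D : Path x.1 (hψ.flip x).1,
    ∀ t, ψ (D t) = x.base * (1 - 2 * (t : ℝ) : ℝ) := by
  have hs : ∀ t ∈ Icc (0 : ℝ) 1, (t : ℂ) ∈ halfDisk := fun t ht => by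
    rcases ht.1.eq_or_lt with h | h
    · rw [← h]
      simpa using zero_mem_halfDisk
    · refine mem_halfDisk_of_re_pos ?_ (by simpa using h)
      rw [Complex.norm_real, Real.norm_eq_abs, abs_of_pos h]
      exact ht.2
  have hmaps : MapsTo (fun t : ℝ => x.base * (t : ℂ)) (Icc (-1) 1) unbranchedDisk := by
    intro t ht
    rcases le_total 0 t with h | h
    · exact mul_mem_unbranchedDisk x.base_eq (hs t ⟨h, ht.2⟩)
    · have := mul_mem_unbranchedDisk (hψ.flip x).base_eq (hs (-t) ⟨by linarith, by linarith [ht.1]⟩)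
      rw [hψ.base_flip] at this
      simpa using this
  obtain ⟨F, hF, hFt, hF1⟩ := hψ.exists_lift (K := Icc (-1 : ℝ) 1) (c := 1) (x := x.1)
    ((convex_Icc (-1 : ℝ) 1).starConvex (by simp)) (by simp) (by fun_prop) hmaps
    (by simp [Pole.base])
  have hF0 : F 0 = hψ.sheet x 0 := by
    have := hψ.eq_sheet x (isPreconnected_Icc (a := (0 : ℝ)) (b := 1))
      (hF.mono (Icc_subset_Icc_left (by norm_num))) (g := fun t : ℝ => (t : ℂ)) (by fun_prop) hs
      (fun t ht => hFt t ⟨by linarith [ht.1], ht.2⟩) (y₀ := 1) (by simp)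
      (by rw [hF1, Complex.ofReal_one, hψ.sheet_one]) (y := 0) (by simp)
    rw [this, Complex.ofReal_zero]
  have hFneg : F (-1) = (hψ.flip x).1 := by
    have := hψ.eq_sheet (hψ.flip x) (isPreconnected_Icc (a := (0 : ℝ)) (b := 1))
      (F := fun t => F (-t)) (g := fun t : ℝ => (t : ℂ))
      (hF.comp (by fun_prop) fun t ht => ⟨by linarith [ht.2], by linarith [ht.1]⟩)
      (by fun_prop) hs
      (fun t ht => by
        rw [hFt (-t) ⟨by linarith [ht.2], by linarith [ht.1]⟩, hψ.base_flip]
        push_cast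
        ring) (y₀ := 0) (by simp)
      (by rw [neg_zero, hF0, Complex.ofReal_zero, hψ.sheet_flip_zero]) (y := 1) (by simp)
    rw [this, Complex.ofReal_one, hψ.sheet_one]
  have hm : ∀ t : unitInterval, 1 - 2 * (t : ℝ) ∈ Icc (-1 : ℝ) 1 := fun t =>
    ⟨by linarith [t.2.2], by linarith [t.2.1]⟩
  refine ⟨⟨⟨fun t => F (1 - 2 * (t : ℝ)), hF.comp_continuous (by fun_prop) hm⟩, ?_, ?_⟩,
    fun t => hFt _ (hm t)⟩
  · simpa using hF1
  · simpa [← hFneg] using congrArg F (by norm_num : (1 : ℝ) - 2 = -1)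

theorem exists_semicircle_lift (x : Pole ψ) : ∃ S : Path x.1 (hψ.rot x).1,
    ∀ t, ψ (S t) = x.base * Complex.exp ((Real.pi * (t : ℝ) : ℝ) * Complex.I) := by
  refine ⟨⟨⟨fun t => hψ.polar x ((Real.pi * (t : ℝ) : ℝ) * Complex.I),
    (hψ.continuousOn_polar x).comp_continuous (by fun_prop)
      fun t => ofReal_mul_I_mem_collar _⟩, ?_, ?_⟩,
    fun t => hψ.apply_polar x (ofReal_mul_I_mem_collar _)⟩
  · simp [hψ.polar_zero]
  · have := hψ.polar_add_pi x zero_mem_collar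
    rw [zero_add, hψ.polar_zero] at this
    simpa using this

omit hψ in
theorem coe_diameter (t : unitInterval) :
    (diameter t : ℂ) = ((2 * (t : ℝ) - 1 : ℝ) : ℂ) * Complex.I := rfl

omit hψ in
theorem coe_leftSemicircle (t : unitInterval) : (leftSemicircle t : ℂ) =
    Complex.I * Complex.exp ((Real.pi * (t : ℝ) : ℝ) * Complex.I) := by
  change Complex.exp (((Real.pi / 2 + Real.pi * t : ℝ) : ℂ) * Complex.I) = _
  push_cast
  rw [add_mul, Complex.exp_add, Complex.exp_pi_div_two_mul_I]

omit hψ in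
theorem coe_rightSemicircle (t : unitInterval) : (rightSemicircle t : ℂ) =
    -Complex.I * Complex.exp ((Real.pi * (t : ℝ) : ℝ) * Complex.I) := by
  change Complex.exp (((-(Real.pi / 2) + Real.pi * t : ℝ) : ℂ) * Complex.I) = _
  push_cast
  rw [add_mul, Complex.exp_add, neg_mul, Complex.exp_neg, Complex.exp_pi_div_two_mul_I,
    Complex.inv_I]

theorem exists_standardLoop_zero_lift {x : Pole ψ} (hx : x.base = -Complex.I) :
    ∃ Γ : Path x.1 (hψ.rot (hψ.flip x)).1, ∀ t, ψ (Γ t) = standardLoop 0 t := by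
  obtain ⟨D, hD⟩ := hψ.exists_diameter_lift x
  obtain ⟨S, hS⟩ := hψ.exists_semicircle_lift (hψ.flip x)
  refine ⟨D.trans S, fun t => ?_⟩
  change _ = ((diameter.trans leftSemicircle t : Disk) : ℂ)
  rw [Path.trans_apply, Path.trans_apply]
  split_ifs
  · rw [hD, hx, coe_diameter]
    push_cast
    ring
  · rw [hS, hψ.base_flip, hx, coe_leftSemicircle, neg_neg]

theorem exists_standardLoop_one_lift {x : Pole ψ} (hx : x.base = -Complex.I) :
    ∃ Γ : Path x.1 (hψ.flip (hψ.rot x)).1, ∀ t, ψ (Γ t) = standardLoop 1 t := by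
  obtain ⟨S, hS⟩ := hψ.exists_semicircle_lift x
  obtain ⟨D, hD⟩ := hψ.exists_diameter_lift (hψ.rot x)
  refine ⟨S.trans D, fun t => ?_⟩
  change _ = ((rightSemicircle.trans diameter.symm t : Disk) : ℂ)
  rw [Path.trans_apply, Path.trans_apply]
  split_ifs
  · rw [hS, hx, coe_rightSemicircle]
  · rw [hD, hψ.base_rot, hx, neg_neg, Path.symm_apply, Function.comp_apply, coe_diameter, unitInterval.coe_symm_eq]
    push_cast
    ring

end DiskCover

/-! ### From the generators' coordinates to the twist's -/

theorem isEmbedding_coe_symm (h : Disk ≃ₜ Disk) : IsEmbedding fun z : Disk => (h.symm z : ℂ) :=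
  IsEmbedding.subtypeVal.comp h.symm.isEmbedding

theorem base_mul_eq_coe_point {ψ : Disk → ℂ} (x : Pole ψ) :
    x.base * (Complex.I * (1 / 2)) = leftPoint ∨ x.base * (Complex.I * (1 / 2)) = rightPoint := by
  rcases x.base_eq with h | h
  · left
    rw [h, coe_leftPoint]
    linear_combination Complex.I_mul_I / 2
  · right
    rw [h, coe_rightPoint]
    linear_combination -Complex.I_mul_I / 2

section

variable {m : ℕ} {a b p : Disk} {σ : Fin 2 → Path p p} {φ : Disk → Disk}

/-- In the generators' coordinates the loops lift to rot ∘ flip and flip ∘ rot on the poles over −i.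
Both are permutations defined by edges of one color, hence involutions. -/
theorem IsBranchedCover.squareLiftsClosed (hσ : IsGeneratorPair σ a b)
    (hφ : IsBranchedCover φ {a, b}) (hG : IsRepresentedBy φ σ (linearGraph m)) {q : Disk}
    (hq : q = a ∨ q = b) : SquareLiftsClosed φ q := by
  obtain ⟨g, hga, hgb, hgσ⟩ := hσ
  have hψ := hφ.diskCover (h := g) (by rw [hga, hgb])
  obtain ⟨e, he⟩ := hG
  have hp : p = g bottomPoint := by
    have := hgσ 0 0
    rwa [(σ 0).source, (standardLoop 0).source] at this
  have hmem : ∀ x : Pole (fun x => (g.symm (φ x) : ℂ)), x.base = -Complex.I →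
      x.1 ∈ φ ⁻¹' {p} := by
    intro x hx
    rw [mem_preimage, mem_singleton_iff, hp, ← g.symm_apply_eq]
    exact Subtype.ext hx
  have hlift : ∀ (x y : Pole (fun x => (g.symm (φ x) : ℂ))) (i : Fin 2) (Γ : Path x.1 y.1),
      (∀ t, (g.symm (φ (Γ t)) : ℂ) = standardLoop i t) → ∀ v, x.1 = e v →
      y.1 = e ((linearGraph m).perm i v) := by
    intro x y i Γ hΓ v hv
    have := he i v Γ Γ.continuous (fun t => by
      rw [hgσ, ← g.symm_apply_eq]
      exact Subtype.ext (hΓ t)) (by rw [Γ.source, hv])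
    rwa [Γ.target] at this
  have hperm : ∀ i v, (linearGraph m).perm i ((linearGraph m).perm i v) = v := fun i v =>
    (linearGraph m).swapAlong_involutive i v
  have h0 : ∀ x : Pole (fun x => (g.symm (φ x) : ℂ)), x.base = -Complex.I →
      hψ.rot (hψ.flip (hψ.rot (hψ.flip x))) = x := by
    intro x hx
    have hx' : (hψ.rot (hψ.flip x)).base = -Complex.I := by
      rw [hψ.base_rot, hψ.base_flip, hx, neg_neg]
    obtain ⟨Γ, hΓ⟩ := hψ.exists_standardLoop_zero_lift hx
    obtain ⟨Γ', hΓ'⟩ := hψ.exists_standardLoop_zero_lift hx'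
    have h1 := hlift _ _ 0 Γ hΓ (e.symm ⟨x.1, hmem x hx⟩) (by simp)
    have h2 := hlift _ _ 0 Γ' hΓ' _ h1
    rw [hperm, Equiv.apply_symm_apply] at h2
    exact Subtype.ext h2
  have h1 : ∀ x : Pole (fun x => (g.symm (φ x) : ℂ)), x.base = -Complex.I →
      hψ.turn (hψ.turn x) = x := by
    intro x hx
    have hx' : (hψ.flip (hψ.rot x)).base = -Complex.I := by
      rw [hψ.base_flip, hψ.base_rot, hx, neg_neg]
    obtain ⟨Γ, hΓ⟩ := hψ.exists_standardLoop_one_lift hx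
    obtain ⟨Γ', hΓ'⟩ := hψ.exists_standardLoop_one_lift hx'
    have h1 := hlift _ _ 1 Γ hΓ (e.symm ⟨x.1, hmem x hx⟩) (by simp)
    have h2 := hlift _ _ 1 Γ' hΓ' _ h1
    rw [hperm, Equiv.apply_symm_apply] at h2
    exact Subtype.ext h2
  -- For poles over i, `turn` is the conjugate by `flip` of the monodromy of the loop 0.
  have h2 : ∀ x : Pole (fun x => (g.symm (φ x) : ℂ)), x.base = Complex.I →
      hψ.turn (hψ.turn x) = x := by
    intro x hx
    have := h0 (hψ.flip x) (by rw [hψ.base_flip, hx])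
    rw [hψ.flip_flip] at this
    change hψ.flip (hψ.rot (hψ.flip (hψ.rot x))) = x
    rw [this, hψ.flip_flip]
  rcases hq with rfl | rfl
  · rw [← squareLiftsClosed_comp_iff (isEmbedding_coe_symm g)]
    have := hψ.squareLiftsClosed_of_turn (.inl rfl) h2
    convert this using 1
    rw [← hga, g.symm_apply_apply, coe_leftPoint]
    linear_combination -Complex.I_mul_I / 2
  · rw [← squareLiftsClosed_comp_iff (isEmbedding_coe_symm g)]
    have := hψ.squareLiftsClosed_of_turn (.inr rfl) h1
    convert this using 1
    rw [← hgb, g.symm_apply_apply, coe_rightPoint]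
    linear_combination Complex.I_mul_I / 2

theorem DiskCover.turn_turn {h : Disk ≃ₜ Disk}
    (hh : ({h leftPoint, h rightPoint} : Set Disk) = {a, b})
    (hψ : DiskCover fun x => (h.symm (φ x) : ℂ)) (hσ : IsGeneratorPair σ a b)
    (hφ : IsBranchedCover φ {a, b}) (hG : IsRepresentedBy φ σ (linearGraph m))
    (x : Pole fun x => (h.symm (φ x) : ℂ)) : hψ.turn (hψ.turn x) = x := by
  apply hψ.turn_turn_of_squareLiftsClosed
  have key : ∀ z : Disk, h z ∈ ({a, b} : Set Disk) →
      SquareLiftsClosed (fun x => (h.symm (φ x) : ℂ)) (z : ℂ) := by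
    intro z hz
    have := (squareLiftsClosed_comp_iff (isEmbedding_coe_symm h)).mpr
      (hφ.squareLiftsClosed hσ hG (q := h z) (by simpa using hz))
    rwa [h.symm_apply_apply] at this
  rcases base_mul_eq_coe_point x with e | e <;> rw [e] <;> apply key <;> rw [← hh] <;> simp

theorem DiskCover.card_pole_eq {h : Disk ≃ₜ Disk}
    (hψ : DiskCover fun x => (h.symm (φ x) : ℂ)) (hσ : IsGeneratorPair σ a b)
    (hG : IsRepresentedBy φ σ (linearGraph m)) :
    Nat.card (Pole fun x => (h.symm (φ x) : ℂ)) = 2 * (m + 1) := by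
  obtain ⟨g, -, -, hgσ⟩ := hσ
  obtain ⟨e, -⟩ := hG
  have hp : p = g bottomPoint := by
    have := hgσ 0 0
    rwa [(σ 0).source, (standardLoop 0).source] at this
  -- The base point is on the boundary in one coordinate system, hence in all of them.
  have hpb : h.symm p ∈ diskBoundary := by
    rw [h.symm.apply_mem_diskBoundary_iff, hp, g.apply_mem_diskBoundary_iff]
    simp [diskBoundary, bottomPoint]
  rw [hψ.card_pole (q := (h.symm p : ℂ)) hpb]
  congr 1
  have e2 : {y // (h.symm (φ y) : ℂ) = h.symm p} ≃ φ ⁻¹' {p} :=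
    Equiv.subtypeEquivRight fun y =>
      ⟨fun hy => h.symm.injective (Subtype.ext hy), fun hy => by
        rw [mem_preimage, mem_singleton_iff] at hy
        rw [hy]⟩
  rw [Nat.card_congr e2, ← Nat.card_congr e]
  simp

end

/-! ### The twist in the plane -/

/-- The model twist by the angle `kπ`, as a map of the plane. -/
noncomputable def planeTwist (k : ℤ) (z : ℂ) : ℂ :=
  z * Complex.exp ((k * Real.pi * twistAngle ‖z‖ : ℝ) * Complex.I)

theorem coe_diskTwist (k : ℤ) (z : Disk) : (diskTwist k z : ℂ) = planeTwist k z := rfl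

theorem continuous_twistAngle : Continuous twistAngle := by
  unfold twistAngle
  fun_prop

theorem continuous_planeTwist (k : ℤ) : Continuous (planeTwist k) := by
  unfold planeTwist
  have := continuous_twistAngle
  fun_prop

theorem twistAngle_of_le {r : ℝ} (h : r ≤ 2 / 3) : twistAngle r = 1 := by
  rw [twistAngle, min_eq_left (by linarith), max_eq_right zero_le_one]

theorem twistAngle_one : twistAngle 1 = 0 := by
  rw [twistAngle]
  norm_num

theorem norm_planeTwist (k : ℤ) (z : ℂ) : ‖planeTwist k z‖ = ‖z‖ := by
  rw [planeTwist, norm_mul, Complex.norm_exp_ofReal_mul_I, mul_one]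

theorem planeTwist_of_norm_le {z : ℂ} (hz : ‖z‖ ≤ 2 / 3) (k : ℤ) :
    planeTwist k z = z * Complex.exp (k * Real.pi * Complex.I) := by
  rw [planeTwist, twistAngle_of_le hz]
  push_cast
  rw [mul_one]

theorem planeTwist_of_norm_eq_one {z : ℂ} (hz : ‖z‖ = 1) (k : ℤ) : planeTwist k z = z := by
  rw [planeTwist, hz, twistAngle_one]
  simp

theorem planeTwist_neg_planeTwist (k : ℤ) (z : ℂ) : planeTwist (-k) (planeTwist k z) = z := by
  rw [planeTwist, norm_planeTwist, planeTwist, mul_assoc, ← Complex.exp_add, ← add_mul,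
    ← Complex.ofReal_add]
  have h : (k : ℝ) * Real.pi * twistAngle ‖z‖ + ((-k : ℤ) : ℝ) * Real.pi * twistAngle ‖z‖ = 0 := by
    push_cast
    ring
  rw [h]
  simp

theorem exp_int_mul_pi_mul_I_sq (k : ℤ) : Complex.exp (k * Real.pi * Complex.I) ^ 2 = 1 := by
  rw [← Complex.exp_nat_mul, Complex.exp_eq_one_iff]
  exact ⟨k, by push_cast; ring⟩

/-- On the circle of radius 1/2 the twist is multiplication by ±1, which preserves the pair of
branch points; other circles contain no branch point. -/
theorem planeTwist_mem_unbranchedDisk {z : ℂ} (hz : z ∈ unbranchedDisk) (k : ℤ) :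
    planeTwist k z ∈ unbranchedDisk := by
  obtain ⟨h1, h2, h3⟩ := hz
  by_cases hn : ‖z‖ = 1 / 2
  · rw [planeTwist_of_norm_le (by rw [hn]; norm_num)]
    rcases sq_eq_sq_iff_eq_or_eq_neg.mp ((exp_int_mul_pi_mul_I_sq k).trans (one_pow 2).symm) with h | h
    · rw [h, mul_one]
      exact ⟨h1, h2, h3⟩
    · rw [h]
      refine ⟨by simpa using h1, fun e => h3 ?_, fun e => h2 ?_⟩
      · linear_combination -e
      · linear_combination -e
  · exact mem_unbranchedDisk_of_norm_ne (by rwa [norm_planeTwist]) (by rwa [norm_planeTwist])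

namespace DiskCover

variable {ψ : Disk → ℂ} (hψ : DiskCover ψ)
include hψ

/-! ### Lifts of the twist on half disks -/

theorem exists_twistedSheet (k : ℤ) (x : Pole ψ) : ∃ F : ℂ → Disk, ContinuousOn F halfDisk ∧
    (∀ z ∈ halfDisk, ψ (F z) = planeTwist k (x.base * z)) ∧ F 1 = x.1 :=
  hψ.exists_lift starConvex_halfDisk one_mem_halfDisk
    ((continuous_planeTwist k).comp (continuous_const_mul x.base)).continuousOn
    (fun _ hz => planeTwist_mem_unbranchedDisk (mul_mem_unbranchedDisk x.base_eq hz) k)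
    (by simp only [mul_one, planeTwist_of_norm_eq_one x.norm_base]; rfl)

/-- The lift of the twist on the half disk around the point `x` over `±i`. -/
noncomputable def twistedSheet (k : ℤ) (x : Pole ψ) : ℂ → Disk :=
  (hψ.exists_twistedSheet k x).choose

theorem continuousOn_twistedSheet (k : ℤ) (x : Pole ψ) :
    ContinuousOn (hψ.twistedSheet k x) halfDisk :=
  (hψ.exists_twistedSheet k x).choose_spec.1

theorem apply_twistedSheet (k : ℤ) (x : Pole ψ) {z : ℂ} (hz : z ∈ halfDisk) :
    ψ (hψ.twistedSheet k x z) = planeTwist k (x.base * z) :=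
  (hψ.exists_twistedSheet k x).choose_spec.2.1 z hz

theorem twistedSheet_one (k : ℤ) (x : Pole ψ) : hψ.twistedSheet k x 1 = x.1 :=
  (hψ.exists_twistedSheet k x).choose_spec.2.2

theorem eq_twistedSheet (k : ℤ) (x : Pole ψ) {Y : Type} [TopologicalSpace Y] {K : Set Y}
    (hK : IsPreconnected K) {F : Y → Disk} {g : Y → ℂ} (hF : ContinuousOn F K)
    (hg : ContinuousOn g K) (hgK : ∀ y ∈ K, g y ∈ halfDisk)
    (h : ∀ y ∈ K, ψ (F y) = planeTwist k (x.base * g y)) {y₀ : Y} (hy₀ : y₀ ∈ K)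
    (h₀ : F y₀ = hψ.twistedSheet k x (g y₀)) {y : Y} (hy : y ∈ K) :
    F y = hψ.twistedSheet k x (g y) :=
  hψ.eqOn_of_lifts hK hF ((hψ.continuousOn_twistedSheet k x).comp hg hgK)
    (fun y hy => by rw [h y hy, Function.comp_apply, hψ.apply_twistedSheet k x (hgK y hy)])
    (fun y hy => by
      rw [h y hy]
      exact planeTwist_mem_unbranchedDisk (mul_mem_unbranchedDisk x.base_eq (hgK y hy)) k)
    hy₀ h₀ hy

theorem twistedSheet_eq_sheet (k : ℤ) (x : Pole ψ) {z : ℂ} (hz : ‖z‖ = 1) (hre : 0 ≤ z.re) :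
    hψ.twistedSheet k x z = hψ.sheet x z := by
  have hz' : Complex.exp (z.arg * Complex.I) = z := by
    have := Complex.norm_mul_exp_arg_mul_I z
    rwa [hz, Complex.ofReal_one, one_mul] at this
  have hm : ∀ θ ∈ Icc (-(Real.pi / 2)) (Real.pi / 2),
      Complex.exp ((θ : ℝ) * Complex.I) ∈ halfDisk := fun θ hθ =>
    exp_mem_halfDisk (ofReal_mul_I_mem_collar θ) (by simpa using abs_le.mpr hθ)
  have := hψ.eq_sheet x (isPreconnected_Icc (a := -(Real.pi / 2)) (b := Real.pi / 2))
    (F := fun θ : ℝ => hψ.twistedSheet k x (Complex.exp (θ * Complex.I)))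
    (g := fun θ : ℝ => Complex.exp (θ * Complex.I))
    ((hψ.continuousOn_twistedSheet k x).comp (by fun_prop) hm) (by fun_prop) hm
    (fun θ hθ => by
      rw [hψ.apply_twistedSheet k x (hm θ hθ), planeTwist_of_norm_eq_one]
      rw [norm_mul, x.norm_base, Complex.norm_exp_ofReal_mul_I, one_mul])
    (y₀ := 0) ⟨by linarith [Real.pi_pos], by linarith [Real.pi_pos]⟩
    (by simp [hψ.twistedSheet_one, hψ.sheet_one]) (y := z.arg)
    (abs_le.mp (Complex.abs_arg_le_pi_div_two_iff.mpr hre))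
  simpa only [hz'] using this

theorem base_rot_zpow (x : Pole ψ) (k : ℤ) :
    ((hψ.rot ^ k) x).base = x.base * Complex.exp (k * Real.pi * Complex.I) := by
  have h1 := hψ.polar_add_int_mul_pi x k zero_mem_collar
  rw [zero_add, hψ.polar_zero] at h1
  have h2 : (k * Real.pi * Complex.I : ℂ) ∈ collar := by
    simpa using ofReal_mul_I_mem_collar (k * Real.pi)
  rw [← hψ.apply_polar x h2, h1]
  rfl

/-- Along the radius from 1 to 2/3 the polar angle of the image goes from 0 to kπ, which leads into
the sheet of `rot ^ k x`. From 2/3 to 0 the angle is constant and the image stays in that sheet. -/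
theorem twistedSheet_zero (k : ℤ) (x : Pole ψ) :
    hψ.twistedSheet k x 0 = hψ.sheet ((hψ.rot ^ k) x) 0 := by
  have hm : ∀ r ∈ Icc (0 : ℝ) 1, (r : ℂ) ∈ halfDisk := fun r hr => by
    rcases hr.1.eq_or_lt with h | h
    · rw [← h]
      simpa using zero_mem_halfDisk
    · refine mem_halfDisk_of_re_pos ?_ (by simpa using h)
      rw [Complex.norm_real, Real.norm_eq_abs, abs_of_pos h]
      exact hr.2
  have hn : ∀ r ∈ Icc (0 : ℝ) 1, ‖x.base * r‖ = r := fun r hr => by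
    rw [norm_mul, x.norm_base, Complex.norm_real, Real.norm_eq_abs, abs_of_nonneg hr.1, one_mul]
  have hcol : ∀ r ∈ Icc (2 / 3 : ℝ) 1, ∀ t : ℝ, (Real.log r + t * Complex.I : ℂ) ∈ collar := by
    intro r hr t
    have h1 : -Real.log 2 < Real.log r := by
      rw [← Real.log_inv]
      exact Real.log_lt_log (by norm_num) (by norm_num; linarith [hr.1])
    have h2 : Real.log r ≤ 0 := Real.log_nonpos (by linarith [hr.1]) hr.2
    simpa [collar] using ⟨h1, h2⟩
  have hexp : ∀ r ∈ Icc (2 / 3 : ℝ) 1, Complex.exp (Real.log r) = r := fun r hr => by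
    rw [← Complex.ofReal_exp, Real.exp_log (by linarith [hr.1])]
  have h23 : (2 / 3 : ℝ) ∈ Icc (2 / 3 : ℝ) 1 := by norm_num
  have hF := hψ.continuousOn_twistedSheet k x
  have step1 := hψ.eq_polar x (isPreconnected_Icc (a := (2 / 3 : ℝ)) (b := 1))
    (F := fun r : ℝ => hψ.twistedSheet k x r)
    (g := fun r : ℝ => Real.log r + ((k * Real.pi * twistAngle r : ℝ) : ℂ) * Complex.I)
    (hF.comp (by fun_prop) fun r hr => hm r ⟨by linarith [hr.1], hr.2⟩)
    (by
      have h1 : ContinuousOn (fun r : ℝ => Real.log r) (Icc (2 / 3 : ℝ) 1) :=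
        Real.continuousOn_log.mono fun r hr => by
          have : r ≠ 0 := by linarith [hr.1]
          exact this
      have h2 := continuous_twistAngle
      fun_prop)
    (fun r hr => hcol r hr _)
    (fun r hr => by
      have hr' : r ∈ Icc (0 : ℝ) 1 := ⟨by linarith [hr.1], hr.2⟩
      rw [hψ.apply_twistedSheet k x (hm r hr'), planeTwist, hn r hr', Complex.exp_add,
        hexp r hr, mul_assoc]) (y₀ := 1) (by norm_num)
    (by simp [hψ.twistedSheet_one, twistAngle_one, hψ.polar_zero]) h23
  have e : (Real.log (2 / 3) + ((k * Real.pi * twistAngle (2 / 3) : ℝ) : ℂ) * Complex.I : ℂ) =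
      Real.log (2 / 3) + k * Real.pi * Complex.I := by
    rw [twistAngle_of_le le_rfl]
    push_cast
    ring
  have hl : (Real.log (2 / 3) : ℂ) ∈ collar := by simpa using hcol _ h23 0
  simp only [e] at step1
  rw [hψ.polar_add_int_mul_pi x k hl, hψ.polar_eq_sheet _ hl (by simpa using Real.pi_div_two_pos.le),
    hexp _ h23] at step1
  have step2 := hψ.eq_sheet ((hψ.rot ^ k) x) (isPreconnected_Icc (a := (0 : ℝ)) (b := 2 / 3))
    (F := fun r : ℝ => hψ.twistedSheet k x r) (g := fun r : ℝ => (r : ℂ))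
    (hF.comp (by fun_prop) fun r hr => hm r ⟨hr.1, by linarith [hr.2]⟩) (by fun_prop)
    (fun r hr => hm r ⟨hr.1, by linarith [hr.2]⟩)
    (fun r hr => by
      have hr' : r ∈ Icc (0 : ℝ) 1 := ⟨hr.1, by linarith [hr.2]⟩
      rw [hψ.apply_twistedSheet k x (hm r hr'), planeTwist_of_norm_le (by rw [hn r hr']; exact hr.2),
        hψ.base_rot_zpow]
      ring) (y₀ := 2 / 3) (by norm_num) step1 (y := 0) (by norm_num)
  simpa using step2

/-- `turn` being an involution means that conjugation by `flip` inverts `rot`, and so inverts all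
its powers. -/
theorem rot_zpow_flip (ht : ∀ x, hψ.turn (hψ.turn x) = x) (k : ℤ) (x : Pole ψ) :
    (hψ.rot ^ k) (hψ.flip x) = hψ.flip ((hψ.rot ^ (-k)) x) := by
  have hff : hψ.flip * hψ.flip = 1 := Equiv.ext hψ.flip_flip
  have hinv : hψ.flip⁻¹ = hψ.flip := inv_eq_of_mul_eq_one_left hff
  have htt : hψ.flip * hψ.rot * hψ.flip * hψ.rot = 1 := Equiv.ext ht
  have hconj : hψ.flip * hψ.rot * hψ.flip⁻¹ = hψ.rot⁻¹ := by
    rw [hinv]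
    exact eq_inv_of_mul_eq_one_left htt
  have key : hψ.flip * hψ.rot ^ k * hψ.flip⁻¹ = hψ.rot ^ (-k) := by
    rw [← conj_zpow, hconj, inv_zpow']
  rw [hinv] at key
  have := congrArg (fun q : Equiv.Perm (Pole ψ) => hψ.flip (q x)) key
  simpa [hψ.flip_flip] using this

theorem twistedSheet_zero_flip_iff (ht : ∀ x, hψ.turn (hψ.turn x) = x) (k : ℤ) (x : Pole ψ) :
    hψ.twistedSheet k (hψ.flip x) 0 = hψ.twistedSheet k x 0 ↔ (hψ.rot ^ (2 * k)) x = x := by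
  rw [hψ.twistedSheet_zero, hψ.twistedSheet_zero]
  have hsplit : (hψ.rot ^ (2 * k)) x = x ↔ (hψ.rot ^ k) x = (hψ.rot ^ (-k)) x := by
    rw [two_mul, zpow_add, zpow_neg, Equiv.Perm.mul_apply, Equiv.Perm.eq_inv_iff_eq]
  rw [hsplit]
  constructor
  · intro h
    have h1 := hψ.eq_flip (by rw [hψ.base_rot_zpow, hψ.base_rot_zpow, hψ.base_flip, neg_mul]) h
    rw [hψ.rot_zpow_flip ht] at h1
    exact (hψ.flip.injective h1).symm
  · intro h
    rw [hψ.rot_zpow_flip ht, ← h, hψ.sheet_flip_zero]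

/-! ### Gluing the lifts -/

omit hψ in
theorem neg_mul_mem_halfDisk {s w : ℂ} (hs : s = Complex.I ∨ s = -Complex.I)
    (hw : w ∈ unbranchedDisk) (h : 0 ≤ (-s * w).re) : -s * w ∈ halfDisk := by
  obtain ⟨h1, h2, h3⟩ := hw
  have hns : ‖s‖ = 1 := by rcases hs with rfl | rfl <;> simp
  have hI := Complex.I_mul_I
  refine ⟨by rwa [norm_mul, norm_neg, hns, one_mul], h, ?_, ?_⟩ <;> intro e <;>
    rcases hs with rfl | rfl
  · exact h3 (by linear_combination Complex.I * e + (w + 1 / 2) * hI)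
  · exact h2 (by linear_combination -Complex.I * e + (w - 1 / 2) * hI)
  · exact h2 (by linear_combination Complex.I * e + (w - 1 / 2) * hI)
  · exact h3 (by linear_combination -Complex.I * e + (w + 1 / 2) * hI)

omit hψ in
theorem mul_neg_mul {s : ℂ} (hs : s = Complex.I ∨ s = -Complex.I) (w : ℂ) : s * (-s * w) = w := by
  rcases hs with rfl | rfl <;> linear_combination -w * Complex.I_mul_I

theorem exists_sheet_eq_of_re {y : Disk} (hy : ψ y ∈ unbranchedDisk) {s : ℂ}
    (hs : s = Complex.I ∨ s = -Complex.I) (h : 0 ≤ (-s * ψ y).re) :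
    ∃ x : Pole ψ, x.base = s ∧ hψ.sheet x (-s * ψ y) = y :=
  hψ.exists_sheet_eq hs (neg_mul_mem_halfDisk hs hy h) (mul_neg_mul hs _).symm

theorem exists_sheet_cover {y : Disk} (hy : ψ y ∈ unbranchedDisk) :
    ∃ x : Pole ψ, ∃ z ∈ halfDisk, hψ.sheet x z = y := by
  rcases le_total 0 (-Complex.I * ψ y).re with h | h
  · obtain ⟨x, -, hx⟩ := hψ.exists_sheet_eq_of_re hy (.inl rfl) h
    exact ⟨x, _, neg_mul_mem_halfDisk (.inl rfl) hy h, hx⟩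
  · have h' : 0 ≤ (-(-Complex.I) * ψ y).re := by
      rw [neg_mul, Complex.neg_re]
      linarith
    obtain ⟨x, -, hx⟩ := hψ.exists_sheet_eq_of_re hy (.inr rfl) h'
    exact ⟨x, _, neg_mul_mem_halfDisk (.inr rfl) hy h', hx⟩

/-- Agreement at the center suffices, since the middle segment without its ends is connected. -/
theorem twistedSheet_flip (k : ℤ)
    (h0 : ∀ x, hψ.twistedSheet k (hψ.flip x) 0 = hψ.twistedSheet k x 0) (x : Pole ψ) {t : ℝ}
    (ht : |t| < 1 / 2) :
    hψ.twistedSheet k (hψ.flip x) (-(t * Complex.I)) = hψ.twistedSheet k x (t * Complex.I) := by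
  have hm : ∀ t ∈ Ioo (-(1 / 2) : ℝ) (1 / 2), (t * Complex.I : ℂ) ∈ halfDisk := fun t ht => by
    have := abs_lt.mpr ht
    exact ofReal_mul_I_mem_halfDisk (by linarith) (by linarith)
  have hm' : ∀ t ∈ Ioo (-(1 / 2) : ℝ) (1 / 2), -(t * Complex.I : ℂ) ∈ halfDisk := fun t ht => by
    have := hm (-t) ⟨by linarith [ht.2], by linarith [ht.1]⟩
    simpa using this
  refine (hψ.eq_twistedSheet k (hψ.flip x) (isPreconnected_Ioo (a := (-(1 / 2) : ℝ)) (b := 1 / 2))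
    (F := fun t : ℝ => hψ.twistedSheet k x (t * Complex.I)) (g := fun t : ℝ => -(t * Complex.I))
    ((hψ.continuousOn_twistedSheet k x).comp (by fun_prop) hm) (by fun_prop) hm'
    (fun t ht => ?_) (y₀ := 0) (by norm_num) ?_ (abs_lt.mp ht)).symm
  · rw [hψ.apply_twistedSheet k x (hm t ht), hψ.base_flip, neg_mul_neg]
  · simp [h0]

/-- Across an outer end agreement is automatic: the end reaches the boundary, where the twisted and
untwisted sheets coincide. -/
theorem twistedSheet_rot (k : ℤ) (x : Pole ψ) {t : ℝ} (ht : 1 / 2 < t) (ht1 : t ≤ 1) :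
    hψ.twistedSheet k (hψ.rot x) (-(t * Complex.I)) = hψ.twistedSheet k x (t * Complex.I) := by
  have hm : ∀ t ∈ Ioc (1 / 2 : ℝ) 1, (t * Complex.I : ℂ) ∈ halfDisk := fun t ht => by
    have := abs_of_pos (show 0 < t by linarith [ht.1])
    exact ofReal_mul_I_mem_halfDisk (by linarith [ht.2]) (by linarith [ht.1])
  have hm' : ∀ t ∈ Ioc (1 / 2 : ℝ) 1, -(t * Complex.I : ℂ) ∈ halfDisk := fun t ht => by
    have := abs_of_pos (show 0 < t by linarith [ht.1])
    have := ofReal_mul_I_mem_halfDisk (t := -t) (by rw [abs_neg]; linarith [ht.2])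
      (by rw [abs_neg]; linarith [ht.1])
    simpa using this
  refine (hψ.eq_twistedSheet k (hψ.rot x) (isPreconnected_Ioc (a := (1 / 2 : ℝ)) (b := 1))
    (F := fun t : ℝ => hψ.twistedSheet k x (t * Complex.I)) (g := fun t : ℝ => -(t * Complex.I))
    ((hψ.continuousOn_twistedSheet k x).comp (by fun_prop) hm) (by fun_prop) hm'
    (fun t ht => ?_) (y₀ := 1) (by norm_num) ?_ ⟨ht, ht1⟩).symm
  · rw [hψ.apply_twistedSheet k x (hm t ht), hψ.base_rot, neg_mul_neg]
  · simp only [Complex.ofReal_one, one_mul]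
    rw [hψ.twistedSheet_eq_sheet k x (by simp) (by simp),
      hψ.twistedSheet_eq_sheet k _ (by simp) (by simp), hψ.sheet_rot_neg_I]

/-- A common point of two sheets over the same half forces equal poles. Over opposite halves it lies
on the diameter, in the middle segment or in one of the two outer ends, where the poles are related
by `flip` or `rot`. -/
theorem twistedSheet_congr (k : ℤ)
    (h0 : ∀ x, hψ.twistedSheet k (hψ.flip x) 0 = hψ.twistedSheet k x 0) {x y : Pole ψ} {z w : ℂ}
    (hz : z ∈ halfDisk) (hw : w ∈ halfDisk) (h : hψ.sheet x z = hψ.sheet y w) :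
    hψ.twistedSheet k x z = hψ.twistedSheet k y w := by
  have hb : x.base * z = y.base * w := by
    rw [← hψ.apply_sheet x hz, ← hψ.apply_sheet y hw, h]
  rcases x.base_eq_or y with hxy | hxy
  · rw [hxy] at hb
    have hzw := mul_left_cancel₀ x.base_ne_zero hb
    subst hzw
    rw [hψ.sheet_injective hz hxy.symm h]
  · have hzw : w = -z := mul_left_cancel₀ x.base_ne_zero (by rw [hxy] at hb; linear_combination hb)
    subst hzw
    have hre : z.re = 0 := le_antisymm (by simpa using hw.2.1) hz.2.1
    obtain ⟨t, rfl⟩ : ∃ t : ℝ, z = t * Complex.I := ⟨z.im, by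
      apply Complex.ext <;> simp [hre]⟩
    have ht1 : |t| ≤ 1 := by simpa using hz.1
    have htn : t ≠ 1 / 2 := fun e => hz.2.2.1 (by rw [e]; push_cast; ring)
    have htn' : t ≠ -(1 / 2) := fun e => hz.2.2.2 (by rw [e]; push_cast; ring)
    rcases lt_or_ge |t| (1 / 2) with ht | ht
    · have : y = hψ.flip x := hψ.sheet_injective hw (by rw [hxy, hψ.base_flip])
        (by rw [hψ.sheet_flip x ht, h])
      rw [this, hψ.twistedSheet_flip k h0 x ht]
    · rcases le_abs'.mp ht with ht' | ht'
      · have ht2 : 1 / 2 < -t := by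
          rcases ht'.lt_or_eq with h | h
          · linarith
          · exact absurd h htn'
        have ht3 : -t ≤ 1 := by linarith [neg_abs_le t]
        have e1 : -((t : ℂ) * Complex.I) = ((-t : ℝ) : ℂ) * Complex.I := by
          push_cast
          ring
        have e2 : (t : ℂ) * Complex.I = -(((-t : ℝ) : ℂ) * Complex.I) := by
          push_cast
          ring
        have : x = hψ.rot y := hψ.sheet_injective hz (by rw [hψ.base_rot, hxy, neg_neg]) (by
          rw [h, e1]
          conv_rhs => rw [e2]
          rw [hψ.sheet_rot y ht2 ht3])
        rw [this, e1]
        conv_lhs => rw [e2]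
        rw [hψ.twistedSheet_rot k y ht2 ht3]
      · have ht2 : 1 / 2 < t := lt_of_le_of_ne ht' htn.symm
        have ht3 : t ≤ 1 := by linarith [le_abs_self t]
        have : y = hψ.rot x := hψ.sheet_injective hw (by rw [hxy, hψ.base_rot])
          (by rw [hψ.sheet_rot x ht2 ht3, h])
        rw [this, hψ.twistedSheet_rot k x ht2 ht3]

theorem exists_continuousOn_twist (k : ℤ)
    (h0 : ∀ x, hψ.twistedSheet k (hψ.flip x) 0 = hψ.twistedSheet k x 0) :
    ∃ T : Disk → Disk, ContinuousOn T (ψ ⁻¹' unbranchedDisk) ∧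
      ∀ x, ∀ z ∈ halfDisk, T (hψ.sheet x z) = hψ.twistedSheet k x z := by
  classical
  have hex : ∀ y : Disk, ∃ y' : Disk, ∀ x, ∀ z ∈ halfDisk, hψ.sheet x z = y →
      y' = hψ.twistedSheet k x z := by
    intro y
    by_cases hy : ∃ x : Pole ψ, ∃ z ∈ halfDisk, hψ.sheet x z = y
    · obtain ⟨x, z, hz, h⟩ := hy
      exact ⟨hψ.twistedSheet k x z, fun x' z' hz' h' =>
        hψ.twistedSheet_congr k h0 hz hz' (h.trans h'.symm)⟩
    · exact ⟨y, fun x z hz h => absurd ⟨x, z, hz, h⟩ hy⟩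
  choose T hT using hex
  refine ⟨T, ?_, fun x z hz => hT _ x z hz rfl⟩
  have hψc := hψ.continuous
  have main : ∀ s, (s = Complex.I ∨ s = -Complex.I) → ∀ y ∈ ψ ⁻¹' unbranchedDisk,
      ContinuousWithinAt T (ψ ⁻¹' unbranchedDisk ∩ {y | 0 ≤ (-s * ψ y).re}) y := by
    intro s hs y hy
    have hcont : Continuous fun y => -s * ψ y := by fun_prop
    have hclosed : IsClosed {y | 0 ≤ (-s * ψ y).re} :=
      isClosed_le continuous_const (Complex.continuous_re.comp hcont)
    by_cases hys : 0 ≤ (-s * ψ y).re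
    · have hyh := neg_mul_mem_halfDisk hs hy hys
      obtain ⟨x, hx, hxy⟩ := hψ.exists_sheet_eq_of_re hy hs hys
      obtain ⟨O, hO, hinj⟩ := hψ.injOn_nhds y hy
      have hmaps : MapsTo (fun y => -s * ψ y)
          (ψ ⁻¹' unbranchedDisk ∩ {y | 0 ≤ (-s * ψ y).re}) halfDisk :=
        fun w hw => neg_mul_mem_halfDisk hs hw.1 hw.2
      have hsheet : ContinuousWithinAt (fun w => hψ.sheet x (-s * ψ w))
          (ψ ⁻¹' unbranchedDisk ∩ {y | 0 ≤ (-s * ψ y).re}) y :=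
        ContinuousWithinAt.comp (t := halfDisk) (f := fun y => -s * ψ y)
          (hψ.continuousOn_sheet x _ hyh) hcont.continuousWithinAt hmaps
      have htw : ContinuousWithinAt (fun w => hψ.twistedSheet k x (-s * ψ w))
          (ψ ⁻¹' unbranchedDisk ∩ {y | 0 ≤ (-s * ψ y).re}) y :=
        ContinuousWithinAt.comp (t := halfDisk) (f := fun y => -s * ψ y)
          (hψ.continuousOn_twistedSheet k x _ hyh) hcont.continuousWithinAt hmaps
      -- Near `y` the sheet through `y` contains every point on this side: its point over the same
      -- image is close to `y`, and `ψ` is injective near `y`.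
      refine htw.congr_of_eventuallyEq ?_ (hT y x _ hyh hxy)
      have h1 : ∀ᶠ w in 𝓝[ψ ⁻¹' unbranchedDisk ∩ {y | 0 ≤ (-s * ψ y).re}] y,
          hψ.sheet x (-s * ψ w) ∈ O := hsheet.eventually_mem (by simpa only [hxy] using hO)
      filter_upwards [h1, mem_nhdsWithin_of_mem_nhds hO, self_mem_nhdsWithin] with w hw1 hw2 hw3
      refine hT w x _ (hmaps hw3) (hinj hw1 hw2 ?_)
      rw [hψ.apply_sheet x (hmaps hw3), hx, mul_neg_mul hs]
    · refine continuousWithinAt_of_notMem_closure fun hcl => hys ?_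
      exact hclosed.closure_subset_iff.mpr inter_subset_right hcl
  intro y hy
  refine ((main _ (.inl rfl) y hy).union (main _ (.inr rfl) y hy)).mono fun w hw => ?_
  rcases le_total 0 (-Complex.I * ψ w).re with h | h
  · exact .inl ⟨hw, h⟩
  · refine .inr ⟨hw, ?_⟩
    rw [mem_ofPred_eq, neg_mul, Complex.neg_re]
    linarith

end DiskCover

/-! ### Extension over the branch points -/

theorem isPreconnected_punctured_ball {δ : ℝ} (hδ : 0 < δ) :
    IsPreconnected {z : ℂ | z ≠ 0 ∧ ‖z‖ < δ} := by
  have h : {z : ℂ | z ≠ 0 ∧ ‖z‖ < δ} = Complex.exp '' {l | l.re < Real.log δ} := by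
    ext z
    constructor
    · rintro ⟨h0, hz⟩
      refine ⟨Complex.log z, ?_, Complex.exp_log h0⟩
      rw [mem_ofPred_eq, Complex.log_re]
      exact Real.log_lt_log (norm_pos_iff.mpr h0) hz
    · rintro ⟨l, hl, rfl⟩
      refine ⟨Complex.exp_ne_zero l, ?_⟩
      rw [Complex.norm_exp, ← Real.exp_log hδ]
      exact Real.exp_lt_exp.mpr hl
  rw [h]
  exact (convex_halfSpace_re_lt _).isPreconnected.image _ (by fun_prop)

namespace IsBranchedCover

variable {φ : Disk → Disk} {P : Set Disk}

/-- In the local form z ↦ z^d, a small punctured disk is connected and its image avoids the branch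
value; continuity of `φ` keeps the other points of `P` away. -/
theorem exists_punctured_nhds (hφ : IsBranchedCover φ P) (hP : P.Finite) {x : Disk}
    (hx : φ x ∈ P) {N : Set Disk} (hN : N ∈ 𝓝 x) :
    ∃ W ⊆ N, W.Nonempty ∧ IsPreconnected W ∧ (∀ y ∈ W, φ y ∉ P) ∧ insert x W ∈ 𝓝 x := by
  obtain ⟨d, hd, u, w, hu, hw, rfl, hw0, huw⟩ := hφ.localForm x hx
  have hQ : φ ⁻¹' (P \ {φ (u 0)})ᶜ ∈ 𝓝 (u 0) :=
    hφ.continuous.continuousAt ((hP.subset sdiff_subset).isClosed.isOpen_compl.mem_nhds (by simp))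
  have hpre : u ⁻¹' (N ∩ φ ⁻¹' (P \ {φ (u 0)})ᶜ) ∈ 𝓝 (0 : ℂ) :=
    hu.continuous.continuousAt (Filter.inter_mem hN hQ)
  obtain ⟨δ, hδ, hball⟩ := Metric.mem_nhds_iff.mp hpre
  have hmem : ∀ z : ℂ, ‖z‖ < δ → u z ∈ N ∧ φ (u z) ∉ P \ {φ (u 0)} := fun z hz =>
    hball (by simpa using hz)
  refine ⟨u '' {z | z ≠ 0 ∧ ‖z‖ < δ}, ?_, ?_,
    (isPreconnected_punctured_ball hδ).image _ hu.continuous.continuousOn, ?_, ?_⟩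
  · rintro _ ⟨z, ⟨-, hz⟩, rfl⟩
    exact (hmem z hz).1
  · refine ⟨_, ((δ / 2 : ℝ) : ℂ), ⟨?_, ?_⟩, rfl⟩
    · exact_mod_cast (half_pos hδ).ne'
    · rw [Complex.norm_real, Real.norm_eq_abs, abs_of_pos (half_pos hδ)]
      exact half_lt_self hδ
  · rintro _ ⟨z, ⟨h0, hz⟩, rfl⟩ hz'
    refine (hmem z hz).2 ⟨hz', fun h => h0 ?_⟩
    rw [mem_singleton_iff, ← hw0, huw] at h
    exact eq_zero_of_pow_eq_zero (hw.injective h)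
  · refine Filter.mem_of_superset
      (hu.isOpenMap.image_mem_nhds (Metric.ball_mem_nhds (0 : ℂ) hδ)) ?_
    rintro _ ⟨z, hz, rfl⟩
    by_cases h0 : z = 0
    · exact .inl (by rw [h0])
    · exact .inr ⟨z, ⟨h0, by simpa using hz⟩, rfl⟩

theorem eventually_notMem (hφ : IsBranchedCover φ P) (hP : P.Finite) {x : Disk}
    (hx : φ x ∈ P) : ∀ᶠ y in 𝓝[≠] x, φ y ∉ P := by
  obtain ⟨W, -, -, -, hW, hxW⟩ := hφ.exists_punctured_nhds hP hx Filter.univ_mem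
  filter_upwards [mem_nhdsWithin_of_mem_nhds hxW, self_mem_nhdsWithin] with y hy hne
  exact hW y (hy.resolve_left hne)

theorem finite_preimage (hφ : IsBranchedCover φ P) (hP : P.Finite) : (φ ⁻¹' P).Finite := by
  have hcomp : IsCompact (φ ⁻¹' P) := (hP.isClosed.preimage hφ.continuous).isCompact
  have hex : ∀ x ∈ φ ⁻¹' P, ∃ N ∈ 𝓝 x, ∀ y ∈ N, φ y ∈ P → y = x := by
    intro x hx
    obtain ⟨W, -, -, -, hW, hxW⟩ := hφ.exists_punctured_nhds hP hx Filter.univ_mem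
    exact ⟨_, hxW, fun y hy hyP => hy.resolve_right fun h => hW y h hyP⟩
  choose! N hN hNx using hex
  obtain ⟨t, ht, hcov⟩ := hcomp.elim_nhds_subcover N hN
  refine t.finite_toSet.subset fun y hy => ?_
  obtain ⟨x, hxt, hyx⟩ := mem_iUnion₂.mp (hcov hy)
  rw [hNx x (ht x hxt) y hyx hy]
  exact hxt

theorem dense_preimage_compl (hφ : IsBranchedCover φ P) (hP : P.Finite) :
    Dense (φ ⁻¹' Pᶜ) := by
  intro x
  by_cases hx : φ x ∈ P
  · rw [mem_closure_iff_nhds]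
    intro N hN
    obtain ⟨W, hWN, ⟨y, hy⟩, -, hW, -⟩ := hφ.exists_punctured_nhds hP hx hN
    exact ⟨y, hWN hy, hW y hy⟩
  · exact subset_closure hx

/-- Near `x` the values of `T` are close to the finite fibre over `f (φ x)`. A punctured
neighborhood of `x` is connected, so they stay close to one point of that fibre. -/
theorem exists_tendsto (hφ : IsBranchedCover φ P) (hP : P.Finite) {f : Disk → Disk}
    (hf : Continuous f) (hfP : ∀ z ∈ P, f z ∈ P) {T : Disk → Disk}
    (hT : ContinuousOn T (φ ⁻¹' Pᶜ)) (hTφ : ∀ y, φ y ∉ P → φ (T y) = f (φ y)) {x : Disk}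
    (hx : φ x ∈ P) :
    ∃ l, φ l = f (φ x) ∧ Filter.Tendsto T (𝓝[≠] x) (𝓝 l) := by
  have hS : (φ ⁻¹' {f (φ x)}).Finite := (hφ.finite_preimage hP).subset fun y hy => by
    have hy' : φ y = f (φ x) := hy
    rw [mem_preimage, hy']
    exact hfP _ hx
  have hclosed : IsClosedMap φ := hφ.continuous.isClosedMap
  have hev := hφ.eventually_notMem hP hx
  -- `φ` is a closed map, so points whose images are near `f (φ x)` lie in any given open set around
  -- the fibre.
  have claim : ∀ O : Set Disk, IsOpen O → φ ⁻¹' {f (φ x)} ⊆ O → ∀ᶠ y in 𝓝[≠] x, T y ∈ O := by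
    intro O hO hSO
    have hC : IsClosed (φ '' Oᶜ) := hclosed _ hO.isClosed_compl
    have hq : f (φ x) ∉ φ '' Oᶜ := by
      rintro ⟨y, hyO, hy⟩
      exact hyO (hSO hy)
    have hfφ : ∀ᶠ y in 𝓝 x, f (φ y) ∉ φ '' Oᶜ :=
      (hf.comp hφ.continuous).continuousAt.eventually_mem (hC.isOpen_compl.mem_nhds hq)
    filter_upwards [hev, mem_nhdsWithin_of_mem_nhds hfφ] with y hy1 hy2
    by_contra hTO
    exact hy2 ⟨T y, hTO, hTφ y hy1⟩
  obtain ⟨U, hU, hdisj⟩ := hS.t2_separation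
  have h1 := claim (⋃ s ∈ φ ⁻¹' {f (φ x)}, U s) (isOpen_biUnion fun s _ => (hU s).2)
    fun s hs => mem_biUnion hs (hU s).1
  rw [eventually_nhdsWithin_iff] at h1
  obtain ⟨W, hWN, ⟨y₀, hy₀⟩, hWc, hWP, hxW⟩ := hφ.exists_punctured_nhds hP hx h1
  have hWx : ∀ y ∈ W, y ∈ ({x}ᶜ : Set Disk) := fun y hy h => hWP y hy (by
    rw [mem_singleton_iff.mp h]
    exact hx)
  obtain ⟨l, hl, hy₀l⟩ := mem_iUnion₂.mp (hWN hy₀ (hWx y₀ hy₀))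
  set V : Set Disk := ⋃ s ∈ φ ⁻¹' {f (φ x)} \ {l}, U s with hV
  have hVo : IsOpen V := isOpen_biUnion fun s _ => (hU s).2
  have hcover : ∀ O : Set Disk, l ∈ O → φ ⁻¹' {f (φ x)} ⊆ O ∪ V := fun O hlO s hs => by
    by_cases hsl : s = l
    · exact .inl (hsl ▸ hlO)
    · exact .inr (mem_biUnion (show s ∈ φ ⁻¹' {f (φ x)} \ {l} from ⟨hs, hsl⟩) (hU s).1)
  have hlV : Disjoint (U l) V := by
    rw [hV, disjoint_iUnion₂_right]
    exact fun s hs => hdisj hl hs.1 fun h => hs.2 h.symm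
  -- The connected set `T '' W` lies in disjoint open sets around the points of the fibre and meets
  -- the one around `l`.
  have hsub : T '' W ⊆ U l := by
    refine (hWc.image T (hT.mono hWP)).subset_left_of_subset_union (hU l).2 hVo hlV ?_
      ⟨T y₀, mem_image_of_mem T hy₀, hy₀l⟩
    rintro _ ⟨y, hy, rfl⟩
    obtain ⟨s, hs, hys⟩ := mem_iUnion₂.mp (hWN hy (hWx y hy))
    by_cases hsl : s = l
    · exact .inl (hsl ▸ hys)
    · exact .inr (mem_biUnion (show s ∈ φ ⁻¹' {f (φ x)} \ {l} from ⟨hs, hsl⟩) hys)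
  refine ⟨l, hl, tendsto_nhds.mpr fun O hO hlO => ?_⟩
  filter_upwards [claim (O ∪ V) (hO.union hVo) (hcover O hlO),
    mem_nhdsWithin_of_mem_nhds hxW, self_mem_nhdsWithin] with y hy1 hy2 hy3
  have hyl : T y ∈ U l := hsub (mem_image_of_mem T (hy2.resolve_left hy3))
  exact hy1.resolve_right fun h => disjoint_left.mp hlV hyl h

theorem exists_continuous_extension (hφ : IsBranchedCover φ P) (hP : P.Finite) {f : Disk → Disk}
    (hf : Continuous f) (hfP : ∀ z ∈ P, f z ∈ P) {T : Disk → Disk}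
    (hT : ContinuousOn T (φ ⁻¹' Pᶜ)) (hTφ : ∀ y, φ y ∉ P → φ (T y) = f (φ y)) :
    ∃ T' : Disk → Disk, Continuous T' ∧ (∀ y, φ y ∉ P → T' y = T y) ∧
      ∀ y, φ (T' y) = f (φ y) := by
  classical
  have hex : ∀ x, ∃ l, φ x ∈ P → φ l = f (φ x) ∧ Filter.Tendsto T (𝓝[≠] x) (𝓝 l) := fun x => by
    by_cases hx : φ x ∈ P
    · obtain ⟨l, hl⟩ := hφ.exists_tendsto hP hf hfP hT hTφ hx
      exact ⟨l, fun _ => hl⟩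
    · exact ⟨x, fun h => absurd h hx⟩
  choose L hL using hex
  have hopen : IsOpen (φ ⁻¹' Pᶜ) := hP.isClosed.isOpen_compl.preimage hφ.continuous
  refine ⟨fun y => if φ y ∈ P then L y else T y, ?_, fun y hy => if_neg hy, fun y => ?_⟩
  · rw [continuous_iff_continuousAt]
    intro x
    by_cases hx : φ x ∈ P
    · rw [continuousAt_iff_punctured_nhds]
      simp only [hx, if_true]
      refine (hL x hx).2.congr' ?_
      filter_upwards [hφ.eventually_notMem hP hx] with y hy
      rw [if_neg hy]
    · refine (hT.continuousAt (hopen.mem_nhds hx)).congr ?_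
      filter_upwards [hopen.mem_nhds hx] with y hy
      exact (if_neg hy).symm
  · by_cases hy : φ y ∈ P
    · simp only [hy, if_true, (hL y hy).1]
    · simp only [hy, if_false, hTφ y hy]

end IsBranchedCover

/-! ### The main theorem -/

theorem modelHalfTwist_zpow_conj {τ h : Disk ≃ₜ Disk} (hτ : ∀ z, τ (h z) = h (modelHalfTwist z))
    (k : ℤ) (z : Disk) : (τ ^ k : Disk ≃ₜ Disk) (h z) = h (diskTwist k z) := by
  have hadd : ∀ (c d : ℝ) (z : Disk), diskTwist c (diskTwist d z) = diskTwist (c + d) z := by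
    intro c d z
    apply Subtype.ext
    simp only [diskTwist, norm_mul, Complex.norm_exp_ofReal_mul_I, mul_one]
    rw [mul_assoc, ← Complex.exp_add]
    congr 2
    push_cast
    ring
  have hτ' : ∀ z, τ (h z) = h (diskTwist 1 z) := hτ
  have hinv : ∀ z, τ⁻¹ (h z) = h (diskTwist (-1) z) := by
    intro z
    apply τ.injective
    rw [hτ', hadd]
    have h1 : diskTwist (1 + -1) z = z := by
      apply Subtype.ext
      simp [diskTwist]
    rw [h1]
    exact τ.apply_symm_apply _
  induction k using Int.induction_on generalizing z with
  | zero =>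
    have h1 : diskTwist ((0 : ℤ) : ℝ) z = z := by
      apply Subtype.ext
      simp [diskTwist]
    rw [h1]
    rfl
  | succ n ih =>
    rw [zpow_add_one]
    change (τ ^ (n : ℤ)) (τ (h z)) = _
    rw [hτ', ih, hadd]
    push_cast
    rfl
  | pred n ih =>
    rw [zpow_sub_one]
    change (τ ^ (-(n : ℤ))) (τ⁻¹ (h z)) = _
    rw [hinv, ih, hadd]
    push_cast
    rw [sub_eq_add_neg]

theorem coe_symm_zpow {τ h : Disk ≃ₜ Disk} (hτ : ∀ z, τ (h z) = h (modelHalfTwist z))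
    (k : ℤ) (z : Disk) :
    (h.symm ((τ ^ k : Disk ≃ₜ Disk) z) : ℂ) = planeTwist k (h.symm z : ℂ) := by
  obtain ⟨w, rfl⟩ := h.surjective z
  rw [modelHalfTwist_zpow_conj hτ, h.symm_apply_apply, h.symm_apply_apply, coe_diskTwist]

/-! ### Existence and inverses of lifts of the twist -/

section

variable {m : ℕ} {a b p : Disk} {φ : Disk → Disk} {τ h : Disk ≃ₜ Disk}

/-- Poles lie on the boundary, so every lift fixes them; uniqueness of lifts then determines it on
each sheet. -/
theorem DiskCover.apply_eq_twistedSheet (hψ : DiskCover fun x => (h.symm (φ x) : ℂ))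
    (hτ : ∀ z, τ (h z) = h (modelHalfTwist z)) {k : ℤ} {T : Disk → Disk} (hT : Continuous T)
    (hlift : IsLift φ (τ ^ k : Disk ≃ₜ Disk) T) (x : Pole fun x => (h.symm (φ x) : ℂ)) {z : ℂ}
    (hz : z ∈ halfDisk) : T (hψ.sheet x z) = hψ.twistedSheet k x z := by
  refine hψ.eq_twistedSheet k x isPreconnected_halfDisk (F := fun z => T (hψ.sheet x z))
    (g := fun z => z) (hT.comp_continuousOn (hψ.continuousOn_sheet x)) continuousOn_id
    (fun _ h => h) (fun z hz => ?_) one_mem_halfDisk ?_ hz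
  · have h1 := congrFun hlift.1 (hψ.sheet x z)
    rw [Function.comp_apply, Function.comp_apply] at h1
    rw [← h1, coe_symm_zpow hτ, ← hψ.apply_sheet x hz]
  · rw [hψ.sheet_one, hψ.twistedSheet_one]
    exact hlift.2 _ (hψ.norm_pole x)

theorem DiskCover.exists_continuous_twist (hφ : IsBranchedCover φ {a, b})
    (hh : ({h leftPoint, h rightPoint} : Set Disk) = {a, b})
    (hψ : DiskCover fun x => (h.symm (φ x) : ℂ))
    (hτ : ∀ z, τ (h z) = h (modelHalfTwist z)) {k : ℤ}
    (h0 : ∀ x, hψ.twistedSheet k (hψ.flip x) 0 = hψ.twistedSheet k x 0) :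
    ∃ T : Disk → Disk, Continuous T ∧ IsLift φ (τ ^ k : Disk ≃ₜ Disk) T := by
  have hmem : ∀ z : Disk, (h.symm z : ℂ) ∈ unbranchedDisk ↔ z ∉ ({a, b} : Set Disk) := by
    intro z
    rw [coe_mem_unbranchedDisk_iff, ← hh]
    simp only [mem_insert_iff, mem_singleton_iff, h.symm_apply_eq]
  have hfin : ({a, b} : Set Disk).Finite := toFinite _
  obtain ⟨T, hT, hTs⟩ := hψ.exists_continuousOn_twist k h0
  have hpre : φ ⁻¹' ({a, b} : Set Disk)ᶜ = (fun x => (h.symm (φ x) : ℂ)) ⁻¹' unbranchedDisk := by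
    ext y
    exact (hmem (φ y)).symm
  -- The inverse twist preserves the complement of the branch points, so the twist cannot take a
  -- branch point there.
  have hτP : ∀ z ∈ ({a, b} : Set Disk), (τ ^ k : Disk ≃ₜ Disk) z ∈ ({a, b} : Set Disk) := by
    intro z hz
    by_contra hcon
    rw [← hmem, coe_symm_zpow hτ] at hcon
    have := planeTwist_mem_unbranchedDisk hcon (-k)
    rw [planeTwist_neg_planeTwist, hmem] at this
    exact this hz
  have hTφ : ∀ y, φ y ∉ ({a, b} : Set Disk) → φ (T y) = (τ ^ k : Disk ≃ₜ Disk) (φ y) := by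
    intro y hy
    obtain ⟨x, z, hz, rfl⟩ := hψ.exists_sheet_cover ((hmem (φ y)).mpr hy)
    rw [hTs x z hz]
    apply h.symm.injective
    apply Subtype.ext
    rw [coe_symm_zpow hτ, hψ.apply_twistedSheet k x hz, ← hψ.apply_sheet x hz]
  obtain ⟨T', hT', hTT', hφT'⟩ := hφ.exists_continuous_extension hfin
    (τ ^ k : Disk ≃ₜ Disk).continuous hτP (hpre ▸ hT) hTφ
  refine ⟨T', hT', funext fun y => (hφT' y).symm, fun y hy => ?_⟩
  have hy1 : ‖(h.symm (φ y) : ℂ)‖ = 1 := (hψ.norm_eq_one_iff y).mpr hy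
  have hyu : (h.symm (φ y) : ℂ) ∈ unbranchedDisk :=
    mem_unbranchedDisk_of_norm_ne hy1.le (by rw [hy1]; norm_num)
  rw [hTT' y ((hmem _).mp hyu)]
  obtain ⟨x, z, hz, rfl⟩ := hψ.exists_sheet_cover hyu
  have hz1 : ‖z‖ = 1 := by
    have := hψ.apply_sheet x hz
    rwa [this, norm_mul, x.norm_base, one_mul] at hy1
  rw [hTs x z hz, hψ.twistedSheet_eq_sheet k x hz1 hz.2.1]

/-- The composite lifts the identity and fixes the poles, so it is the identity on every sheet and,
by density, everywhere. The form `l = -k` lets the two lifts be exchanged. -/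
theorem DiskCover.lift_leftInverse (hφ : IsBranchedCover φ {a, b})
    (hh : ({h leftPoint, h rightPoint} : Set Disk) = {a, b})
    (hψ : DiskCover fun x => (h.symm (φ x) : ℂ)) (hτ : ∀ z, τ (h z) = h (modelHalfTwist z))
    {k l : ℤ} (hkl : l = -k) {T T' : Disk → Disk} (hT : Continuous T) (hT' : Continuous T')
    (hlift : IsLift φ (τ ^ k : Disk ≃ₜ Disk) T) (hlift' : IsLift φ (τ ^ l : Disk ≃ₜ Disk) T') :
    Function.LeftInverse T' T := by
  refine congrFun (Continuous.ext_on (hφ.dense_preimage_compl (toFinite _)) (hT'.comp hT)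
    continuous_id fun y hy => ?_)
  have hyu : (h.symm (φ y) : ℂ) ∈ unbranchedDisk := by
    rw [coe_mem_unbranchedDisk_iff]
    rw [mem_preimage, mem_compl_iff, ← hh] at hy
    simpa only [mem_insert_iff, mem_singleton_iff, h.symm_apply_eq] using hy
  obtain ⟨x, z, hz, rfl⟩ := hψ.exists_sheet_cover hyu
  refine hψ.eq_sheet x isPreconnected_halfDisk (F := fun z => T' (T (hψ.sheet x z)))
    (g := fun z => z) ((hT'.comp hT).comp_continuousOn (hψ.continuousOn_sheet x)) continuousOn_id
    (fun _ h => h) (fun z hz => ?_) one_mem_halfDisk ?_ hz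
  · have h1 := congrFun hlift.1 (hψ.sheet x z)
    have h2 := congrFun hlift'.1 (T (hψ.sheet x z))
    rw [Function.comp_apply, Function.comp_apply] at h1 h2
    rw [← h2, coe_symm_zpow hτ, ← h1, coe_symm_zpow hτ, hkl, planeTwist_neg_planeTwist,
      ← hψ.apply_sheet x hz]
  · have hb : x.1 ∈ diskBoundary := hψ.norm_pole x
    rw [hψ.sheet_one, hlift.2 _ hb, hlift'.2 _ hb]

end

theorem mainTheorem7 (m : ℕ) (a b p : Disk) (σ : Fin 2 → Path p p)
    (hσ : IsGeneratorPair σ a b)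
    (φ : Disk → Disk) (hφ : IsBranchedCover φ {a, b})
    (hG : IsRepresentedBy φ σ (linearGraph m))
    (α : Set Disk) (hα : IsArc α a b)
    (τ : Disk ≃ₜ Disk) (hτ : IsHalfTwist τ α) (k : ℤ) :
    ((∃ T : Disk → Disk, Continuous T ∧ IsLift φ (τ ^ k : Disk ≃ₜ Disk) T) ↔
        ((m : ℤ) + 1) ∣ k) ∧
      ((∃ T : Disk ≃ₜ Disk, IsLift φ (τ ^ k : Disk ≃ₜ Disk) T) ↔ ((m : ℤ) + 1) ∣ k) := by
  obtain ⟨h, hhα, hτh⟩ := hτ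
  have hh := hα.ends_eq hhα
  have hψ := hφ.diskCover hh
  have ht := hψ.turn_turn hh hσ hφ hG
  have hcard := hψ.card_pole_eq hσ hG
  have hiff : ∀ (k : ℤ) (x : Pole fun x => (h.symm (φ x) : ℂ)),
      hψ.twistedSheet k (hψ.flip x) 0 = hψ.twistedSheet k x 0 ↔ ((m : ℤ) + 1) ∣ k := by
    intro k x
    rw [hψ.twistedSheet_zero_flip_iff ht, hψ.rot_zpow_apply_eq_iff, hcard]
    push_cast
    -- The 2 in 2k cancels the 2 in the number 2(m+1) of poles.
    exact mul_dvd_mul_iff_left two_ne_zero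
  have hne : Nonempty (Pole fun x => (h.symm (φ x) : ℂ)) :=
    (Nat.card_pos_iff.mp (by rw [hcard]; positivity)).1
  have hnec : (∃ T : Disk → Disk, Continuous T ∧ IsLift φ (τ ^ k : Disk ≃ₜ Disk) T) →
      ((m : ℤ) + 1) ∣ k := by
    rintro ⟨T, hT, hlift⟩
    obtain ⟨x⟩ := hne
    -- Both forced values at 0 are the value of `T` at the single point shared by the sheets of `x`
    -- and `flip x`.
    rw [← hiff k x, ← hψ.apply_eq_twistedSheet hτh hT hlift _ DiskCover.zero_mem_halfDisk,
      ← hψ.apply_eq_twistedSheet hτh hT hlift _ DiskCover.zero_mem_halfDisk, hψ.sheet_flip_zero]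
  have hsuf : ((m : ℤ) + 1) ∣ k → ∃ T : Disk ≃ₜ Disk, IsLift φ (τ ^ k : Disk ≃ₜ Disk) T := by
    intro hdvd
    obtain ⟨T, hT, hlift⟩ := hψ.exists_continuous_twist hφ hh hτh fun x => (hiff k x).mpr hdvd
    obtain ⟨T', hT', hlift'⟩ := hψ.exists_continuous_twist hφ hh hτh
      fun x => (hiff (-k) x).mpr (hdvd.neg_right)
    exact ⟨⟨⟨T, T', hψ.lift_leftInverse hφ hh hτh rfl hT hT' hlift hlift',
      hψ.lift_leftInverse hφ hh hτh (neg_neg k).symm hT' hT hlift' hlift⟩, hT, hT'⟩, hlift⟩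
  refine ⟨⟨hnec, fun hd => ?_⟩, fun ⟨T, hT⟩ => hnec ⟨T, T.continuous, hT⟩, hsuf⟩
  obtain ⟨T, hT⟩ := hsuf hd
  exact ⟨T, T.continuous, hT⟩
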